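/- Let $u=(u_1,\dots,u_n)$ be a nonzero real vector with $0\le u_1\le\dots\le u_n$. A vector $a\in\mathbb R_{\ge 0}^n$ is a $u$-parking function if its nondecreasing rearrangement $b_1\le\dots\le b_n$ satisfies $b_i\le u_i$ for all $i$; $\mathrm{PF}(u)$ is the convex hull of all $u$-parking functions. Let $d=(d_1<\dots<d_\ell)$ be the distinct positive entries of $u$ and $m=(m_0,m_1,\dots,m_\ell)$, where $m_0$ is the number of zeros of $u$ and $m_i$ the number of entries equal to $d_i$; $(m,d)$ is called the MD pair of $u$, it determines $u$, and we write $\mathrm{PF}(m,d)=\mathrm{PF}(u)$. For a polytope $P\subset\mathbb R^n$, a nonempty face is a set of the form $\{x\in P: h\cdot x\ge h\cdot y\ \forall y\in P\}$ with $h\in\mathbb R^n$; the face poset is the set of nonempty faces ordered by inclusion. The normal cone at a face $F$ is $\{w: w\cdot x\ge w\cdot y\ \forall x\in F,\ y\in P\}$, and the normal fan $\Sigma(P)$ is the set of the normal cones at all nonempty faces, ordered by inclusion. A skewed binary partition of $[0,n]=\{0,\dots,n\}$ is a tuple $\mathcal B=(B_{-1},B_0,B_1,\dots,B_k)$, $k\ge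 0$, of disjoint sets with union $[0,n]$, some of which are marked homogeneous, such that: only blocks with at least two elements may be homogeneous; $B_{-1}$ is not homogeneous; $B_0$ is homogeneous if $|B_0|\ge2$; $0\in B_{-1}\cup B_0$; if $0\in B_{-1}$, then $|B_{-1}|\ge 2$ and $B_0=\emptyset$; and $B_i\ne\emptyset$ for $i\ge1$. Its preorder $\preceq_{\mathcal B}$ on $[0,n]$ is: $p\preceq_{\mathcal B}q$ iff $p=q$, or $p\in B_i$, $q\in B_j$ with $i<j$, or $p,q$ lie in a common homogeneous block. Its type is $(b_{-1},b_0,\dots,b_k)$, where for $i\ge1$, $b_i=|B_i|$ if $B_i$ is not homogeneous and $b_i=|B_i|^\star$ if it is; $(b_{-1},b_0)=(|B_{-1}|,(|B_0|-1)^\circ)$ if $0\in B_0$; and $(b_{-1},b_0)=(|B_{-1}|-1,0)$ if $0\in B_{-1}$ (the superscripts $\star,\circ$ are formal marks). The sliced preorder cone is $$\tilde\sigma_{\mathcal B}=\{(c_1,\dots,c_n)\in\mathbb R^n: c_i\le c_j\text{ whenever } i\preceq_{\mathcal B}j,\ i,j\in[0,n]\},\qquad c_0:=0.$$ Contracting an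 edge of the Hasse diagram of a preorder, that is, a pair $a,b$ such that the class of $b$ covers the class of $a$, means passing to the smallest preorder that contains the given one and in which also $b\preceq a$. We say that $\mathcal C$ is a contraction of $\mathcal B$ if $\preceq_{\mathcal C}$ is obtained from $\preceq_{\mathcal B}$ by a finite (possibly empty) sequence of edge contractions. Put $r=m_1+\dots+m_\ell$ and $\Omega_m=\{\mathbf a_0,\dots,\mathbf a_r\}$, where $\mathbf a_0=(m_0,0,m_1,\dots,m_\ell)$ if $m_0>0$ and $\mathbf a_0=(0,0^\circ,m_1,\dots,m_\ell)$ if $m_0=0$; for $1\le i<r$, $\mathbf a_i=(m_0+i,0^\circ,m_1+\dots+m_g-i,m_{g+1},\dots,m_\ell)$ with $g\ge 1$ determined by $m_1+\dots+m_{g-1}\le i<m_1+\dots+m_g$; and $\mathbf a_r=(n,0^\circ)$. Let $\mathcal{SBP}(m)$ be the set of skewed binary partitions of $[0,n]$ that are contractions of some skewed binary partition with type in $\Omega_m$, ordered by $\mathcal B\le\mathcal B'$ iff $\mathcal B$ is a contraction of $\mathcal B'$. Then, for every MD pair $(m,d)$: (1) the map $\mathcal B\mapsto\tilde\sigma_{\mathcal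 B}$ is a poset isomorphism from $\mathcal{SBP}(m)$ onto $\Sigma(\mathrm{PF}(m,d))$; (2) the face poset of $\mathrm{PF}(m,d)$ is isomorphic to the dual of $\mathcal{SBP}(m)$; (3) the combinatorial type depends only on $m$: if $(m,d)$ and $(m,d')$ are MD pairs, then $\mathrm{PF}(m,d)$ and $\mathrm{PF}(m,d')$ have isomorphic face posets. -/

import Mathlib

namespace ParkingPolytope

open Matrix

/-! ### Faces, normal cones and normal fans -/

/-- `F` is the face of `P` on which some linear functional attains its maximum over `P`. -/
def IsFace {n : ℕ} (P F : Set (Fin n → ℝ)) : Prop :=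
  ∃ h : Fin n → ℝ, F = {x | x ∈ P ∧ ∀ y ∈ P, h ⬝ᵥ y ≤ h ⬝ᵥ x}

/-- The set of nonempty faces of `P`; as a subtype it is ordered by inclusion. -/
def faces {n : ℕ} (P : Set (Fin n → ℝ)) : Set (Set (Fin n → ℝ)) :=
  {F | F.Nonempty ∧ IsFace P F}

/-- The normal cone of `P` at `F`. -/
def normalCone {n : ℕ} (F P : Set (Fin n → ℝ)) : Set (Fin n → ℝ) :=
  {w | ∀ x ∈ F, ∀ y ∈ P, w ⬝ᵥ y ≤ w ⬝ᵥ x}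

/-- The set of normal cones of `P` at its nonempty faces; as a subtype it is ordered by
inclusion. -/
def normalFan {n : ℕ} (P : Set (Fin n → ℝ)) : Set (Set (Fin n → ℝ)) :=
  {σ | ∃ F ∈ faces P, σ = normalCone F P}

/-! ### Parking function polytopes -/

/-- `a` is a `u`-parking function: it is nonnegative and its nondecreasing rearrangement
`a ∘ Tuple.sort a` is bounded by `u` in every coordinate. -/
def IsParkingFunction {n : ℕ} (u a : Fin n → ℝ) : Prop :=
  (∀ i, 0 ≤ a i) ∧ ∀ i, a (Tuple.sort a i) ≤ u i

/-- The parking function polytope `PF(u)`. -/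
def PF {n : ℕ} (u : Fin n → ℝ) : Set (Fin n → ℝ) :=
  convexHull ℝ {a | IsParkingFunction u a}

/-- The data vector `(d_1, …, d_ℓ)` of `u`: its distinct positive entries in increasing order. -/
noncomputable def dataVector {n : ℕ} (u : Fin n → ℝ) : List ℝ :=
  ((Finset.univ.image u).filter (fun x => 0 < x)).sort (· ≤ ·)

/-- The multiplicity vector `(m_0, m_1, …, m_ℓ)` of `u`: the number of zeros of `u`, followed by
the number of occurrences of each entry of the data vector. -/
noncomputable def multiplicityVector {n : ℕ} (u : Fin n → ℝ) : List ℕ :=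
  (0 :: dataVector u).map fun x => (Finset.univ.filter fun i => u i = x).card

/-- `u` is a nonzero nondecreasing vector of nonnegative reals and `(m, d)` is its MD pair.
The pair `(m, d)` determines `u`, and `PF(m, d)` means `PF(u)`. -/
structure IsMDPairOf {n : ℕ} (m : List ℕ) (d : List ℝ) (u : Fin n → ℝ) : Prop where
  nonneg : ∀ i, 0 ≤ u i
  monotone : Monotone u
  ne_zero : u ≠ 0
  multiplicity : multiplicityVector u = m
  data : dataVector u = d

/-! ### Contractions of preorders and sliced preorder cones -/

/-- `b` covers `a` in the preorder `r`: the class of `b` covers the class of `a` in the poset of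
equivalence classes of `r`. -/
def Covers {α : Type*} (r : α → α → Prop) (a b : α) : Prop :=
  r a b ∧ ¬ r b a ∧ ∀ c, r a c → r c b → r c a ∨ r b c

/-- The preorder `s` arises from the preorder `r` by contracting one edge of the Hasse diagram:
for some `b` covering `a`, the classes of `a` and `b` are merged, so that `s` is the smallest
preorder containing `r` in which also `b` lies below `a`. -/
def ContractsEdge {α : Type*} (r s : α → α → Prop) : Prop :=
  ∃ a b, Covers r a b ∧
    s = Relation.ReflTransGen (fun x y => r x y ∨ (x = b ∧ y = a))

/-- The preorder `s` is a contraction of the preorder `r`: it arises by a finite (possibly empty)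
sequence of edge contractions. -/
def IsContraction {α : Type*} (s r : α → α → Prop) : Prop :=
  Relation.ReflTransGen ContractsEdge r s

/-- The sliced preorder cone of a preorder `r` on `[0, n]`. The coordinates `c_1, …, c_n` are
indexed by `Fin n`, and `Fin.cons 0 c` is `(0, c_1, …, c_n)`. -/
def slicedCone {n : ℕ} (r : Fin (n + 1) → Fin (n + 1) → Prop) : Set (Fin n → ℝ) :=
  {c | ∀ i j, r i j →
    (Fin.cons 0 c : Fin (n + 1) → ℝ) i ≤ (Fin.cons 0 c : Fin (n + 1) → ℝ) j}

/-! ### Skewed binary partitions -/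

/-- A skewed binary partition `(B_{-1}, B_0, B_1, …, B_k)` of `[0, n]`. The block `B_i` is
`block (i + 1)`, and `homog` marks the homogeneous blocks. Blocks with at most one element carry
no mark. -/
structure SkewedBinaryPartition (n : ℕ) where
  k : ℕ
  block : Fin (k + 2) → Finset (Fin (n + 1))
  homog : Fin (k + 2) → Bool
  disjoint : ∀ i j, i ≠ j → Disjoint (block i) (block j)
  cover : ∀ p, ∃ i, p ∈ block i
  homog_first : homog 0 = false
  homog_second : 2 ≤ (block 1).card → homog 1 = true
  zero_mem : 0 ∈ block 0 ∨ 0 ∈ block 1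
  of_zero_mem_first : 0 ∈ block 0 → 2 ≤ (block 0).card ∧ block 1 = ∅
  two_le_of_homog : ∀ i, homog i = true → 2 ≤ (block i).card
  nonempty : ∀ i : Fin k, (block i.succ.succ).Nonempty

/-- Entries of skewed binary compositions: `i`, `i^∘` and `i^⋆`. -/
inductive Entry where
  | plain (i : ℕ)
  | circ (i : ℕ)
  | star (i : ℕ)

namespace SkewedBinaryPartition

variable {n : ℕ}

/-- The preorder of a skewed binary partition: elements of an earlier block lie below those of a
later one, elements of one homogeneous block are equivalent, and distinct elements of one
non-homogeneous block are incomparable. Empty blocks have no influence. -/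
def rel (B : SkewedBinaryPartition n) (p q : Fin (n + 1)) : Prop :=
  p = q ∨ ∃ i j, p ∈ B.block i ∧ q ∈ B.block j ∧ (i < j ∨ (i = j ∧ B.homog i = true))

/-- The type `(b_{-1}, b_0, b_1, …, b_k)` of a skewed binary partition. -/
def type (B : SkewedBinaryPartition n) : List Entry :=
  (if 0 ∈ B.block 1 then
      [Entry.plain (B.block 0).card, Entry.circ ((B.block 1).card - 1)]
    else
      [Entry.plain ((B.block 0).card - 1), Entry.plain 0]) ++
  List.ofFn fun i : Fin B.k =>
    if B.homog i.succ.succ = true then Entry.star (B.block i.succ.succ).card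
    else Entry.plain (B.block i.succ.succ).card

end SkewedBinaryPartition

/-- The first element `a_0` of `Ω_m`, for `m = (m₀, ms)`. -/
def omegaZero (m₀ : ℕ) (ms : List ℕ) : List Entry :=
  (if 0 < m₀ then [Entry.plain m₀, Entry.plain 0] else [Entry.plain 0, Entry.circ 0]) ++
    ms.map Entry.plain

/-- The set `Ω_m = {a_0, …, a_r}` of skewed binary compositions, `r = m_1 + ⋯ + m_ℓ`. The three
parts of the union for `m = (m₀, ms)` are `a_0`, the `a_i` with `1 ≤ i < r`, and `a_r`. -/
def Omega : List ℕ → Set (List Entry)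
  | [] => ∅
  | m₀ :: ms =>
    {omegaZero m₀ ms} ∪
    {b | ∃ i g : ℕ, 1 ≤ i ∧ 1 ≤ g ∧ (ms.take (g - 1)).sum ≤ i ∧ i < (ms.take g).sum ∧
      b = [Entry.plain (m₀ + i), Entry.circ 0, Entry.plain ((ms.take g).sum - i)] ++
        (ms.drop g).map Entry.plain} ∪
    {[Entry.plain (m₀ + ms.sum), Entry.circ 0]}

/-- `SBP(m)`: the skewed binary partitions of `[0, n]` that are contractions of a skewed binary
partition with type in `Ω_m`. -/
def SBP (n : ℕ) (m : List ℕ) : Type :=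
  {B : SkewedBinaryPartition n //
    ∃ A : SkewedBinaryPartition n, A.type ∈ Omega m ∧ IsContraction B.rel A.rel}

/-- `SBP(m)` is ordered by contraction. Antisymmetry holds as well; it is implied by an order
isomorphism with a family of sets ordered by inclusion. -/
instance (n : ℕ) (m : List ℕ) : Preorder (SBP n m) where
  le B B' := IsContraction B.1.rel B'.1.rel
  le_refl _ := Relation.ReflTransGen.refl
  le_trans _ _ _ h h' := Relation.ReflTransGen.trans h' h

end ParkingPolytope

/-! Maximizing a functional w over PF(u) is a greedy problem: sort the coordinates by w, hand out
the entries of u in that order, and put 0 where w is negative; where w vanishes, both choices are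
optimal. Along such maximizers the coordinate p ranges between `minVal` and `maxVal`, which depend
only on w_p. These intervals are ordered like the values of w and meet at most in endpoints. The
element 0 of [0, n] acts as an extra coordinate with w-value 0. The preorder `relOf u w` puts p
below a different q when w_p ≤ w_q and the lower end at p is less than the upper end at q.

Geometry: the normal cone at the face of w is the sliced cone of `relOf u w`
(`normalCone_maxFace_eq`). Exchanging two coordinates, or raising or lowering one, gives every
inequality of the cone. Conversely, Abel summation over the level sets of w' shows that the greedy
point for w also maximizes each w' in the cone (`dotProduct_le_place`).

Order: passing to a face of a cone turns some of its inequalities into equalities, so `relOf u w` is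
generated by a larger cone's preorder together with reversals of some of its pairs
(`relOf_eq_reflTransGen`). On a finite set, being generated by reversals is the same as being a
sequence of edge contractions (`GeneratedByReversals.isContraction` and its converse). Hence
inclusion of normal cones is contraction, and the family of all `relOf u w` is closed under
contraction.

Combinatorics: a type in Ω_m amounts to a cut K with m₀ ≤ K ≤ n (`mem_Omega_iff`), and a partition
of that type is such a cut together with an ordering of the coordinates (`IsChamber`). The preorder
of each chamber is some `relOf u w` (`IsChamber.exists_rel_eq`), and the chamber cones cover the
whole space (`exists_chamber_mem`). Every `relOf u w` is the preorder of a skewed binary partition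
(`exists_rel_eq_relOf`), and that partition is unique (`rel_injective`). So SBP(m) is the normal
fan. Faces correspond to normal cones with inclusion reversed, and SBP(m) does not involve d. -/

namespace ParkingPolytope

open Matrix

/-! ### Contractions of preorders -/

section Contraction

variable {α : Type*}

/-- `s` contains `r` and is generated by `r` together with reversed pairs of `r`. -/
def GeneratedByReversals (r s : α → α → Prop) : Prop :=
  r ≤ s ∧ ∀ x y, s x y → Relation.ReflTransGen (fun x y => r x y ∨ (r y x ∧ s x y)) x y

lemma GeneratedByReversals.rfl' (r : α → α → Prop) : GeneratedByReversals r r :=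
  ⟨le_rfl, fun _ _ h => .single (.inl h)⟩

/-- Read a generating path from `y` to `x` backwards. Since `t x y` closes the path to a cycle, all
its points lie in one class of `t`, so each step of `r` becomes an admissible reversal and each
reversal becomes a step of `r`. -/
lemma GeneratedByReversals.reverse {r s t : α → α → Prop} [IsPreorder α t]
    (hrs : GeneratedByReversals r s) (hst : s ≤ t) {x y : α} (hs : s y x) (ht : t x y) :
    Relation.ReflTransGen (fun x y => r x y ∨ (r y x ∧ t x y)) x y := by
  have key : ∀ z, Relation.ReflTransGen (fun x y => r x y ∨ (r y x ∧ s x y)) y z → t z y →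
      Relation.ReflTransGen (fun x y => r x y ∨ (r y x ∧ t x y)) z y := by
    intro z hz
    induction hz with
    | refl => intro _; exact .refl
    | @tail b c hb hbc ih =>
      intro hc
      have hbc' : t b c := by
        rcases hbc with h | h
        · exact hst _ _ (hrs.1 _ _ h)
        · exact hst _ _ h.2
      have hyb : t y b := by
        clear ih hbc hbc' hc
        induction hb with
        | refl => exact refl_of t y
        | tail _ h ih =>
          refine trans_of t ih ?_
          rcases h with h | h
          · exact hst _ _ (hrs.1 _ _ h)
          · exact hst _ _ h.2
      have hcb : t c b := trans_of t hc hyb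
      refine .head ?_ (ih (trans_of t hbc' hc))
      rcases hbc with h | h
      · exact .inr ⟨h, hcb⟩
      · exact .inl h.1
  exact key x (hrs.2 _ _ hs) ht

lemma GeneratedByReversals.trans {r s t : α → α → Prop} [IsPreorder α t]
    (hrs : GeneratedByReversals r s) (hst : GeneratedByReversals s t) :
    GeneratedByReversals r t := by
  refine ⟨hrs.1.trans hst.1, fun x y h => ?_⟩
  have := hst.2 _ _ h
  clear h
  induction this with
  | refl => exact .refl
  | tail _ h ih =>
    refine ih.trans ?_
    rcases h with h | h
    · refine Relation.ReflTransGen.mono (fun a b hab => ?_) _ _ (hrs.2 _ _ h)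
      rcases hab with hab | hab
      · exact .inl hab
      · exact .inr ⟨hab.1, hst.1 _ _ hab.2⟩
    · exact hrs.reverse hst.1 h.1 h.2

lemma ContractsEdge.isPreorder {r s : α → α → Prop} (h : ContractsEdge r s) : IsPreorder α s := by
  obtain ⟨a, b, -, rfl⟩ := h
  exact { refl := fun _ => .refl, trans := fun _ _ _ => .trans }

lemma ContractsEdge.generatedByReversals {r s : α → α → Prop} (h : ContractsEdge r s) :
    GeneratedByReversals r s := by
  obtain ⟨a, b, hab, rfl⟩ := h
  refine ⟨fun x y h => .single (.inl h), fun x y h => Relation.ReflTransGen.mono ?_ _ _ h⟩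
  rintro x y (h | ⟨rfl, rfl⟩)
  · exact .inl h
  · exact .inr ⟨hab.1, .single (.inr ⟨rfl, rfl⟩)⟩

lemma IsContraction.generatedByReversals {r s : α → α → Prop} [IsPreorder α r]
    (h : IsContraction s r) : IsPreorder α s ∧ GeneratedByReversals r s := by
  induction h with
  | refl => exact ⟨inferInstance, .rfl' r⟩
  | tail _ h ih =>
    have := ih.1
    have := h.isPreorder
    exact ⟨h.isPreorder, ih.2.trans h.generatedByReversals⟩

/-- In a finite preorder, a strict relation inside a class of a coarser preorder is refined by a
covering relation inside that class. -/
lemma exists_covers [Finite α] {r s : α → α → Prop} [IsPreorder α r] [IsPreorder α s]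
    (hrs : r ≤ s) {a y : α} (hay : r a y) (hya : ¬ r y a) (hs : s y a) :
    ∃ b, Covers r a b ∧ s b a := by
  classical
  have hwf : WellFounded (fun x y : α => r x y ∧ ¬ r y x) := by
    have : IsTrans α (fun x y : α => r x y ∧ ¬ r y x) :=
      ⟨fun a b c h h' => ⟨trans_of r h.1 h'.1, fun h'' => h'.2 (trans_of r h'' h.1)⟩⟩
    have : Std.Irrefl (fun x y : α => r x y ∧ ¬ r y x) := ⟨fun a h => h.2 h.1⟩
    exact Finite.wellFounded_of_trans_of_irrefl _
  -- A minimal element strictly above `a` within its `s`-class is a cover, because everything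
  -- between stays in that class.
  obtain ⟨b, ⟨hab, hba, hsb⟩, hmin⟩ :=
    hwf.has_min {b | r a b ∧ ¬ r b a ∧ s b a} ⟨y, hay, hya, hs⟩
  refine ⟨b, ⟨hab, hba, fun c hac hcb => ?_⟩, hsb⟩
  by_contra hcon
  push Not at hcon
  exact hmin c ⟨hac, hcon.1, trans_of s (hrs _ _ hcb) hsb⟩ ⟨hcb, hcon.2⟩

/-- Induction on the number of pairs of `s` missing from `r`. As long as some reversal is missing, a
covering pair inside an `s`-class can be contracted without leaving `s`. This replaces sequences of
contractions by a condition that only compares `r` with `s`. -/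
lemma GeneratedByReversals.isContraction [Finite α] {r s : α → α → Prop} [hr : IsPreorder α r]
    [IsPreorder α s] (h : GeneratedByReversals r s) : IsContraction s r := by
  classical
  obtain ⟨N, hN⟩ : ∃ N, N = Set.ncard {p : α × α | s p.1 p.2 ∧ ¬ r p.1 p.2} := ⟨_, rfl⟩
  induction N using Nat.strong_induction_on generalizing r with
  | _ N ih =>
  by_cases hall : ∀ x y, r y x → s x y → r x y
  · have : r = s := by
      refine le_antisymm h.1 fun x y hxy => ?_
      have := h.2 _ _ hxy
      clear hxy
      induction this with
      | refl => exact refl_of r x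
      | tail _ h' ih' =>
        refine trans_of r ih' ?_
        rcases h' with h' | h'
        · exact h'
        · exact hall _ _ h'.1 h'.2
    subst this
    exact Relation.ReflTransGen.refl
  · push Not at hall
    obtain ⟨y, a, hay, hs, hya⟩ := hall
    obtain ⟨b, hab, hsb⟩ := exists_covers h.1 hay hya hs
    have hc : ContractsEdge r (Relation.ReflTransGen (fun x y => r x y ∨ (x = b ∧ y = a))) :=
      ⟨a, b, hab, rfl⟩
    set r' := Relation.ReflTransGen (fun x y => r x y ∨ (x = b ∧ y = a)) with hr'
    have := hc.isPreorder
    have hrr' : r ≤ r' := hc.generatedByReversals.1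
    have hr's : r' ≤ s := by
      intro x y hxy
      induction hxy with
      | refl => exact refl_of s x
      | tail _ h' ih' =>
        refine trans_of s ih' ?_
        rcases h' with h' | ⟨rfl, rfl⟩
        · exact h.1 _ _ h'
        · exact hsb
    have hgen : GeneratedByReversals r' s := by
      refine ⟨hr's, fun x y hxy =>
        Relation.ReflTransGen.mono (fun u v huv => ?_) _ _ (h.2 x y hxy)⟩
      rcases huv with huv | huv
      · exact .inl (hrr' _ _ huv)
      · exact .inr ⟨hrr' _ _ huv.1, huv.2⟩
    have hlt : Set.ncard {p : α × α | s p.1 p.2 ∧ ¬ r' p.1 p.2} < N := by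
      rw [hN]
      refine Set.ncard_lt_ncard ?_ (Set.toFinite _)
      refine ⟨fun p hp => ⟨hp.1, fun h' => hp.2 (hrr' _ _ h')⟩, fun hsub => ?_⟩
      exact (hsub (show (b, a) ∈ _ from ⟨hsb, hab.2.1⟩)).2 (.single (.inr ⟨rfl, rfl⟩))
    exact Relation.ReflTransGen.head hc (ih _ hlt hgen rfl)

end Contraction

/-! ### Sliced preorder cones -/

section SlicedCone

variable {n : ℕ}

/-- The vector `(0, w_1, …, w_n)`. -/
def ext0 (w : Fin n → ℝ) : Fin (n + 1) → ℝ := Fin.cons 0 w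

@[simp] lemma ext0_zero (w : Fin n → ℝ) : ext0 w 0 = 0 := rfl

@[simp] lemma ext0_succ (w : Fin n → ℝ) (i : Fin n) : ext0 w i.succ = w i := rfl

lemma mem_slicedCone {r : Fin (n + 1) → Fin (n + 1) → Prop} {c : Fin n → ℝ} :
    c ∈ slicedCone r ↔ ∀ i j, r i j → ext0 c i ≤ ext0 c j := Iff.rfl

lemma ext0_sub_const (f : Fin (n + 1) → ℝ) (p : Fin (n + 1)) :
    ext0 (fun i => f i.succ - f 0) p = f p - f 0 := by
  refine Fin.cases ?_ (fun i => ?_) p <;> simp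

lemma slicedCone_anti {r s : Fin (n + 1) → Fin (n + 1) → Prop} (h : r ≤ s) :
    slicedCone s ⊆ slicedCone r := fun _ hc i j hij => hc i j (h _ _ hij)

/-- The test vector is the indicator of the up-set of `p` under `s`, shifted so that its coordinate
at 0 vanishes. It lies in the cone of `s`, and a relation `r p q` then forces `q` into the up-set.
Thus a cone determines its preorder. -/
lemma le_of_slicedCone_subset {r s : Fin (n + 1) → Fin (n + 1) → Prop} [IsPreorder _ s]
    (h : slicedCone s ⊆ slicedCone r) : r ≤ s := by
  classical
  intro p q hpq
  have hmem : (fun i : Fin n => (if s p i.succ then (1 : ℝ) else 0) - if s p 0 then 1 else 0) ∈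
      slicedCone s := by
    rw [mem_slicedCone]
    intro i j hij
    rw [ext0_sub_const (fun x => if s p x then (1 : ℝ) else 0),
      ext0_sub_const (fun x => if s p x then (1 : ℝ) else 0)]
    refine sub_le_sub_right ?_ _
    by_cases hi : s p i
    · rw [if_pos hi, if_pos (trans_of s hi hij)]
    · rw [if_neg hi]; split_ifs <;> norm_num
  have := mem_slicedCone.1 (h hmem) p q hpq
  rw [ext0_sub_const (fun x => if s p x then (1 : ℝ) else 0),
      ext0_sub_const (fun x => if s p x then (1 : ℝ) else 0), if_pos (refl_of s p)] at this
  by_contra hcon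
  rw [if_neg hcon] at this
  linarith

lemma eq_of_slicedCone_eq {r s : Fin (n + 1) → Fin (n + 1) → Prop} [IsPreorder _ r]
    [IsPreorder _ s] (h : slicedCone r = slicedCone s) : r = s :=
  le_antisymm (le_of_slicedCone_subset h.ge) (le_of_slicedCone_subset h.le)

/-- `w` lies in the relative interior of the cone of `r`. -/
def StrictFor (w : Fin n → ℝ) (r : Fin (n + 1) → Fin (n + 1) → Prop) : Prop :=
  w ∈ slicedCone r ∧ ∀ i j, r i j → ext0 w i = ext0 w j → r j i

/-- The size of the down-set is monotone, and it ties on comparable elements only if they are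
equivalent. Subtracting its value at 0 normalizes it. -/
lemma exists_strictFor (r : Fin (n + 1) → Fin (n + 1) → Prop) [IsPreorder _ r] :
    ∃ w : Fin n → ℝ, StrictFor w r := by
  classical
  let f : Fin (n + 1) → ℝ := fun x => ((Finset.univ.filter fun y => r y x).card : ℝ)
  have hsub : ∀ i j, r i j →
      (Finset.univ.filter fun y => r y i) ⊆ Finset.univ.filter fun y => r y j := by
    intro i j hij y hy
    simp only [Finset.mem_filter, Finset.mem_univ, true_and] at hy ⊢
    exact trans_of r hy hij
  refine ⟨fun i => f i.succ - f 0, fun i j hij => ?_, fun i j hij heq => ?_⟩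
  · change ext0 _ i ≤ ext0 _ j
    rw [ext0_sub_const, ext0_sub_const]
    exact sub_le_sub_right (Nat.cast_le.2 (Finset.card_le_card (hsub i j hij))) _
  · rw [ext0_sub_const, ext0_sub_const, sub_left_inj, Nat.cast_inj] at heq
    have := Finset.eq_of_subset_of_card_le (hsub i j hij) heq.ge
    have hj : j ∈ Finset.univ.filter fun y => r y i := by
      rw [this]; simp [refl_of r j]
    simpa using hj

/-- A small step from a relative interior point against any vector of the cone that respects the
equalities of the smaller face stays inside the cone. -/
lemma exists_sub_smul_mem {r : Fin (n + 1) → Fin (n + 1) → Prop} {w w' : Fin n → ℝ}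
    (hw : w ∈ slicedCone r) (h : ∀ i j, r i j → ext0 w i = ext0 w j → ext0 w' j ≤ ext0 w' i) :
    ∃ ε : ℝ, 0 < ε ∧ w - ε • w' ∈ slicedCone r := by
  classical
  have hev : ∀ i j, ∀ᶠ ε in nhdsWithin (0 : ℝ) (Set.Ioi 0), r i j →
      ext0 w i - ε * ext0 w' i ≤ ext0 w j - ε * ext0 w' j := by
    intro i j
    by_cases hij : r i j
    · rcases (mem_slicedCone.1 hw i j hij).lt_or_eq with hlt | heq
      · have hcont : Filter.Tendsto
            (fun ε : ℝ => (ext0 w j - ε * ext0 w' j) - (ext0 w i - ε * ext0 w' i))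
            (nhdsWithin 0 (Set.Ioi 0)) (nhds (ext0 w j - ext0 w i)) := by
          have : Continuous
            (fun ε : ℝ => (ext0 w j - ε * ext0 w' j) - (ext0 w i - ε * ext0 w' i)) := by fun_prop
          have h0 := this.tendsto 0
          simp only [zero_mul, sub_zero] at h0
          exact h0.mono_left nhdsWithin_le_nhds
        filter_upwards [hcont.eventually (lt_mem_nhds (sub_pos.2 hlt))] with ε hε _
        linarith
      · have := h i j hij heq
        filter_upwards [self_mem_nhdsWithin] with ε hε _
        have hε : 0 < ε := hε
        nlinarith
    · exact Filter.Eventually.of_forall fun _ h => absurd h hij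
  have hall := Filter.eventually_all.2 fun i => Filter.eventually_all.2 (hev i)
  obtain ⟨ε, hε, hpos⟩ := (hall.and self_mem_nhdsWithin).exists
  refine ⟨ε, hpos, fun i j hij => ?_⟩
  have hext : ∀ p, ext0 (w - ε • w') p = ext0 w p - ε * ext0 w' p := by
    intro p
    refine Fin.cases ?_ (fun i => ?_) p <;> simp
  change ext0 _ i ≤ ext0 _ j
  rw [hext, hext]
  exact hε i j hij

end SlicedCone

/-! ### Faces and normal cones -/

section Faces

variable {n : ℕ}

/-- The face of `P` on which `w` is maximal. -/
def maxFace (P : Set (Fin n → ℝ)) (w : Fin n → ℝ) : Set (Fin n → ℝ) :=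
  {x | x ∈ P ∧ ∀ y ∈ P, w ⬝ᵥ y ≤ w ⬝ᵥ x}

lemma mem_normalCone_maxFace (P : Set (Fin n → ℝ)) (w : Fin n → ℝ) :
    w ∈ normalCone (maxFace P w) P := fun _ hx y hy => hx.2 y hy

/-- Faces are exposed: the functional that cuts out `F'` lies in the normal cone at `F'`, so
inclusion of the cones makes it maximal along `F`. -/
lemma normalCone_subset_iff {P F F' : Set (Fin n → ℝ)} (hF : IsFace P F) (hF' : IsFace P F') :
    normalCone F' P ⊆ normalCone F P ↔ F ⊆ F' := by
  obtain ⟨h, rfl⟩ := hF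
  obtain ⟨h', rfl⟩ := hF'
  constructor
  · intro hsub x hx
    exact ⟨hx.1, hsub (mem_normalCone_maxFace P h') x hx⟩
  · exact fun hsub w hw x hx => hw x (hsub hx)

/-- Taking normal cones is an order-reversing bijection from the faces to the normal fan. -/
noncomputable def facesOrderIso (P : Set (Fin n → ℝ)) : faces P ≃o (normalFan P)ᵒᵈ :=
  RelIso.ofSurjective
    (OrderEmbedding.ofMapLEIff
      (fun F : faces P => OrderDual.toDual (⟨normalCone F.1 P, F.1, F.2, rfl⟩ : normalFan P))
      fun F F' => normalCone_subset_iff F.2.2 F'.2.2)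
    (by
      rintro ⟨σ, F, hF, rfl⟩
      exact ⟨⟨F, hF⟩, rfl⟩)

/-- The normal cone at the face of `w` is the smallest face containing `w` of any normal cone
containing `w`. -/
lemma mem_normalCone_maxFace_of_sub {P : Set (Fin n → ℝ)} {w₀ w w' : Fin n → ℝ} {ε : ℝ}
    (hne : (maxFace P w₀).Nonempty) (hε : 0 < ε) (hw' : w' ∈ normalCone (maxFace P w₀) P)
    (hsub : w - ε • w' ∈ normalCone (maxFace P w₀) P) : w' ∈ normalCone (maxFace P w) P := by
  obtain ⟨x₀, hx₀⟩ := hne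
  intro x hx y hy
  have h1 := hw' x₀ hx₀ y hy
  have h2 := hw' x₀ hx₀ x hx.1
  have h3 := hsub x₀ hx₀ x hx.1
  have h4 := hx.2 x₀ hx₀.1
  simp only [sub_dotProduct, smul_dotProduct, smul_eq_mul] at h3
  -- Both `w'` and `w - ε • w'` are maximal at `x₀`, while `w` is maximal at `x`; neither can lose
  -- value from `x₀` to `x`, so `w'` takes its maximum at `x` too.
  nlinarith

end Faces

/-! ### Sums controlled by level sets -/

section LevelSets

variable {ι : Type*}

/-- Layer-cake decomposition: with `δ` the least positive value of `w`, subtract `δ` times the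
indicator of the positive set. This leaves fewer positive entries, and the superlevel sets of the
remainder are those of `w` shifted by `δ`. -/
lemma sum_mul_nonneg_of_superlevel [Fintype ι] {w b : ι → ℝ} (hw : 0 ≤ w)
    (h : ∀ t, 0 < t → 0 ≤ ∑ i with t ≤ w i, b i) : 0 ≤ ∑ i, w i * b i := by
  classical
  obtain ⟨N, hN⟩ : ∃ N, N = (Finset.univ.filter fun i => 0 < w i).card := ⟨_, rfl⟩
  induction N using Nat.strong_induction_on generalizing w with
  | _ N ih =>
  by_cases hne : (Finset.univ.filter fun i => 0 < w i).Nonempty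
  · obtain ⟨i₀, hi₀, hmin⟩ := Finset.exists_min_image _ w hne
    simp only [Finset.mem_filter, Finset.mem_univ, true_and] at hi₀ hmin
    set δ := w i₀
    let w' : ι → ℝ := fun i => if 0 < w i then w i - δ else 0
    have hw' : 0 ≤ w' := by
      intro i
      by_cases hi : 0 < w i
      · simpa [w', hi] using hmin i hi
      · simp [w', hi]
    have hsum : ∑ i, w i * b i = ∑ i, w' i * b i + δ * ∑ i with δ ≤ w i, b i := by
      rw [Finset.sum_filter, Finset.mul_sum, ← Finset.sum_add_distrib]
      refine Finset.sum_congr rfl fun i _ => ?_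
      by_cases hi : 0 < w i
      · simp only [w', if_pos hi, if_pos (hmin i hi)]; ring
      · have h0 : w i = 0 := le_antisymm (not_lt.1 hi) (hw i)
        have hδ : ¬ δ ≤ w i := by rw [h0]; exact not_le.2 hi₀
        rw [if_neg hδ, h0]; simp only [w', if_neg hi]; ring
    have hlt : (Finset.univ.filter fun i => 0 < w' i).card < N := by
      rw [hN]
      refine Finset.card_lt_card ⟨fun i hi => ?_, fun hsub => ?_⟩
      · simp only [Finset.mem_filter, Finset.mem_univ, true_and] at hi ⊢
        by_contra hcon
        simp [w', hcon] at hi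
      · have := hsub (show i₀ ∈ _ by simpa using hi₀)
        simp [w', δ] at this
    rw [hsum]
    refine add_nonneg (ih _ hlt hw' (fun t ht => ?_) rfl) (mul_nonneg hi₀.le (h δ hi₀))
    have : (Finset.univ.filter fun i => t ≤ w' i) = Finset.univ.filter fun i => t + δ ≤ w i := by
      ext i
      simp only [Finset.mem_filter, Finset.mem_univ, true_and]
      by_cases hi : 0 < w i
      · simp only [w', if_pos hi]; constructor <;> intro h <;> linarith
      · simp only [w', if_neg hi]; constructor <;> intro h <;> linarith
    rw [this]
    exact h _ (by linarith)
  · rw [Finset.not_nonempty_iff_eq_empty, Finset.filter_eq_empty_iff] at hne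
    refine Finset.sum_nonneg fun i _ => ?_
    have : w i = 0 := le_antisymm (not_lt.1 (hne (Finset.mem_univ i))) (hw i)
    simp [this]

lemma sum_mul_nonneg_of_level [Fintype ι] {w b : ι → ℝ}
    (hpos : ∀ t, 0 < t → 0 ≤ ∑ i with t ≤ w i, b i)
    (hneg : ∀ t, t < 0 → ∑ i with w i ≤ t, b i ≤ 0) : 0 ≤ ∑ i, w i * b i := by
  have h1 : 0 ≤ ∑ i, max (w i) 0 * b i := by
    refine sum_mul_nonneg_of_superlevel (fun i => le_max_right _ _) fun t ht => ?_
    convert hpos t ht using 3 with i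
    simp [ht.not_ge]
  have h2 : 0 ≤ ∑ i, max (-w i) 0 * (-b i) := by
    refine sum_mul_nonneg_of_superlevel (fun i => le_max_right _ _) fun t ht => ?_
    rw [Finset.sum_neg_distrib, neg_nonneg]
    convert hneg (-t) (by linarith) using 3 with i
    simp only [le_max_iff, ht.not_ge, or_false]
    exact le_neg
  have : ∑ i, w i * b i = ∑ i, max (w i) 0 * b i + ∑ i, max (-w i) 0 * (-b i) := by
    rw [← Finset.sum_add_distrib]
    refine Finset.sum_congr rfl fun i _ => ?_
    rcases le_total 0 (w i) with h | h
    · rw [max_eq_left h, max_eq_right (by linarith)]; ring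
    · rw [max_eq_right h, max_eq_left (by linarith)]; ring
  rw [this]
  exact add_nonneg h1 h2

/-- A set whose values dominate all values outside maximizes the sum among sets of its size. -/
lemma sum_le_sum_of_dominating [DecidableEq ι] {u : ι → ℝ} {J M : Finset ι} (hc : J.card = M.card)
    (h : ∀ j ∈ M, ∀ j' ∉ M, u j' ≤ u j) : ∑ j ∈ J, u j ≤ ∑ j ∈ M, u j := by
  rw [← Finset.sum_inter_add_sum_sdiff J M, ← Finset.sum_inter_add_sum_sdiff M J,
    Finset.inter_comm M J]
  refine add_le_add_right ?_ _
  have hcard := Finset.card_sdiff_comm hc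
  by_cases hne : (J \ M).Nonempty
  · obtain ⟨i, hi, hmax⟩ := Finset.exists_max_image _ u hne
    calc ∑ j ∈ J \ M, u j ≤ (J \ M).card • u i := Finset.sum_le_card_nsmul _ _ _ hmax
      _ = (M \ J).card • u i := by rw [hcard]
      _ ≤ ∑ j ∈ M \ J, u j := Finset.card_nsmul_le_sum _ _ _ fun j hj =>
          h j (Finset.mem_sdiff.1 hj).1 i (Finset.mem_sdiff.1 hi).2
  · rw [Finset.not_nonempty_iff_eq_empty] at hne
    have h' : M \ J = ∅ := by
      rw [← Finset.card_eq_zero, ← hcard, hne, Finset.card_empty]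
    rw [hne, h']

end LevelSets

lemma mem_iff_lt_card {n : ℕ} {S : Finset (Fin n)} (hS : ∀ i j, i ≤ j → j ∈ S → i ∈ S)
    (j : Fin n) : j ∈ S ↔ (j : ℕ) < S.card := by
  constructor
  · intro hj
    have : Finset.Iic j ⊆ S := fun i hi => hS i j (Finset.mem_Iic.1 hi) hj
    have := Finset.card_le_card this
    rw [Fin.card_Iic] at this
    omega
  · intro hj
    by_contra hcon
    have : S ⊆ Finset.Iio j := fun i hi =>
      Finset.mem_Iio.2 (not_le.1 fun h => hcon (hS j i h hi))
    have := Finset.card_le_card this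
    rw [Fin.card_Iio] at this
    omega

/-! ### Parking functions -/

section Parking

variable {n : ℕ} {u : Fin n → ℝ}

/-- Pigeonhole: if the sorted vector exceeded `u` at position `i`, the `i + 1` coordinates `τ 0, …,
τ i`, all with values at most `u i`, would have to be among the first `i` in sorted order. So any
ordering of the coordinates may certify the bound. -/
lemma isParkingFunction_of_perm (hu : Monotone u) {a : Fin n → ℝ} (ha : ∀ i, 0 ≤ a i)
    (τ : Equiv.Perm (Fin n)) (h : ∀ i, a (τ i) ≤ u i) : IsParkingFunction u a := by
  classical
  refine ⟨ha, fun i => ?_⟩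
  by_contra hcon
  push Not at hcon
  have h1 : (Finset.Iic i).image τ ⊆ (Finset.Iio i).image (Tuple.sort a) := by
    intro p hp
    obtain ⟨j, hj, rfl⟩ := Finset.mem_image.1 hp
    refine Finset.mem_image.2 ⟨(Tuple.sort a).symm (τ j), ?_, by simp⟩
    rw [Finset.mem_Iio]
    by_contra hlt
    have := Tuple.monotone_sort a (not_lt.1 hlt)
    simp only [Function.comp_apply, Equiv.apply_symm_apply] at this
    have h2 := hu (Finset.mem_Iic.1 hj)
    have h3 := h j
    linarith
  have := Finset.card_le_card h1
  rw [Finset.card_image_of_injective _ τ.injective,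
    Finset.card_image_of_injective _ (Tuple.sort a).injective, Fin.card_Iic, Fin.card_Iio] at this
  omega

lemma IsParkingFunction.mem {a : Fin n → ℝ} (h : IsParkingFunction u a) : a ∈ PF u :=
  subset_convexHull ℝ _ h

lemma nonneg_of_mem_PF {y : Fin n → ℝ} (hy : y ∈ PF u) (i : Fin n) : 0 ≤ y i := by
  have : PF u ⊆ {y | 0 ≤ y i} := by
    refine convexHull_min (fun a ha => ha.1 i) ?_
    exact convex_halfSpace_ge (f := fun y : Fin n → ℝ => y i) ⟨fun _ _ => rfl, fun _ _ => rfl⟩ 0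
  exact this hy

/-- The bound is linear in `y`, so it suffices to check parking functions; there the entries on `V`
are dominated by as many entries of `u`, and `M` carries the largest ones. -/
lemma sum_le_of_mem_PF {y : Fin n → ℝ} (hy : y ∈ PF u) {V M : Finset (Fin n)}
    (hc : V.card = M.card) (h : ∀ j ∈ M, ∀ j' ∉ M, u j' ≤ u j) :
    ∑ i ∈ V, y i ≤ ∑ j ∈ M, u j := by
  classical
  have : PF u ⊆ {y | ∑ i ∈ V, y i ≤ ∑ j ∈ M, u j} := by
    refine convexHull_min (fun a ha => ?_) ?_
    · change ∑ i ∈ V, a i ≤ _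
      calc ∑ i ∈ V, a i = ∑ j ∈ V.image (Tuple.sort a).symm, a (Tuple.sort a j) := by
            rw [Finset.sum_image fun _ _ _ _ h => (Tuple.sort a).symm.injective h]
            simp
        _ ≤ ∑ j ∈ V.image (Tuple.sort a).symm, u j := Finset.sum_le_sum fun j _ => ha.2 j
        _ ≤ ∑ j ∈ M, u j := by
            refine sum_le_sum_of_dominating ?_ h
            rw [Finset.card_image_of_injective _ (Tuple.sort a).symm.injective, hc]
    · refine convex_halfSpace_le (f := fun y : Fin n → ℝ => ∑ i ∈ V, y i) ⟨fun x y => ?_,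
        fun c x => ?_⟩ _
      · simp [Finset.sum_add_distrib]
      · simp [Finset.mul_sum]
  exact this hy

open Classical in
/-- The vector that places the entries of `u` along `τ` on the coordinates in `S` and vanishes
elsewhere. -/
noncomputable def place (u : Fin n → ℝ) (τ : Equiv.Perm (Fin n)) (S : Set (Fin n)) : Fin n → ℝ :=
  fun r => if r ∈ S then u (τ.symm r) else 0

lemma place_of_mem {τ : Equiv.Perm (Fin n)} {S : Set (Fin n)} {r : Fin n} (h : r ∈ S) :
    place u τ S r = u (τ.symm r) := if_pos h

lemma place_of_notMem {τ : Equiv.Perm (Fin n)} {S : Set (Fin n)} {r : Fin n} (h : r ∉ S) :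
    place u τ S r = 0 := if_neg h

lemma place_nonneg (hu0 : ∀ i, 0 ≤ u i) (τ : Equiv.Perm (Fin n)) (S : Set (Fin n)) (r : Fin n) :
    0 ≤ place u τ S r := by
  unfold place
  split_ifs
  · exact hu0 _
  · exact le_rfl

lemma place_isParkingFunction (hu0 : ∀ i, 0 ≤ u i) (hu : Monotone u) (τ : Equiv.Perm (Fin n))
    (S : Set (Fin n)) : IsParkingFunction u (place u τ S) := by
  refine isParkingFunction_of_perm hu (place_nonneg hu0 τ S) τ fun i => ?_
  unfold place
  split_ifs
  · simp
  · exact hu0 i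

lemma place_mem (hu0 : ∀ i, 0 ≤ u i) (hu : Monotone u) (τ : Equiv.Perm (Fin n))
    (S : Set (Fin n)) : place u τ S ∈ PF u := (place_isParkingFunction hu0 hu τ S).mem

end Parking

/-! ### The preorder of a linear functional -/

section RelOf

variable {n : ℕ}

/-- The `k`-th smallest entry of `u`, counted from `1`, and `0` for `k = 0`. -/
noncomputable def nthEntry (u : Fin n → ℝ) (k : ℕ) : ℝ :=
  -- Clamping at the last entry keeps the function monotone beyond `n`; `minVal` may ask for
  -- position `n + 1`.
  if h : 0 < n ∧ 0 < k then u ⟨min (k - 1) (n - 1), by omega⟩ else 0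

/-- The number of entries of `w` below `t`. -/
noncomputable def numLT (w : Fin n → ℝ) (t : ℝ) : ℕ := (Finset.univ.filter fun i => w i < t).card

/-- The number of entries of `w` that are at most `t`. -/
noncomputable def numLE (w : Fin n → ℝ) (t : ℝ) : ℕ := (Finset.univ.filter fun i => w i ≤ t).card

/-- The least value, at a coordinate where `w` has the value `t`, of a parking function
maximizing `w`. -/
noncomputable def minVal (u w : Fin n → ℝ) (t : ℝ) : ℝ :=
  if 0 < t then nthEntry u (numLT w t + 1) else 0

/-- The largest value, at a coordinate where `w` has the value `t`, of a parking function
maximizing `w`. -/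
noncomputable def maxVal (u w : Fin n → ℝ) (t : ℝ) : ℝ :=
  if 0 ≤ t then nthEntry u (numLE w t) else 0

/-- The preorder on `[0, n]` whose sliced cone is the normal cone of `PF u` at the face
maximizing `w`. -/
def relOf (u w : Fin n → ℝ) (p q : Fin (n + 1)) : Prop :=
  p = q ∨ (ext0 w p ≤ ext0 w q ∧ minVal u w (ext0 w p) < maxVal u w (ext0 w q))

variable {u : Fin n → ℝ}

lemma nthEntry_zero : nthEntry u 0 = 0 := by simp [nthEntry]

lemma nthEntry_succ (i : Fin n) : nthEntry u (i + 1) = u i := by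
  have hi := i.2
  unfold nthEntry
  rw [dif_pos (by omega)]
  congr
  simp
  omega

lemma nthEntry_nonneg (hu0 : ∀ i, 0 ≤ u i) (k : ℕ) : 0 ≤ nthEntry u k := by
  unfold nthEntry
  split_ifs
  · exact hu0 _
  · exact le_rfl

lemma nthEntry_mono (hu0 : ∀ i, 0 ≤ u i) (hu : Monotone u) : Monotone (nthEntry u) := by
  intro k l hkl
  by_cases h : 0 < n ∧ 0 < k
  · unfold nthEntry
    rw [dif_pos h, dif_pos (by omega)]
    apply hu
    simp only [Fin.mk_le_mk]
    omega
  · have : nthEntry u k = 0 := dif_neg h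
    rw [this]
    exact nthEntry_nonneg hu0 l

variable {w : Fin n → ℝ}

lemma numLE_le_numLT {s t : ℝ} (h : s < t) : numLE w s ≤ numLT w t := by
  refine Finset.card_le_card fun i hi => ?_
  simp only [Finset.mem_filter, Finset.mem_univ, true_and] at hi ⊢
  linarith

lemma numLT_lt_numLE (i : Fin n) : numLT w (w i) < numLE w (w i) := by
  refine Finset.card_lt_card ⟨fun j hj => ?_, fun hsub => ?_⟩
  · simp only [Finset.mem_filter, Finset.mem_univ, true_and] at hj ⊢
    exact hj.le
  · have := hsub (show i ∈ _ by simp)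
    simp at this

lemma minVal_of_nonpos {t : ℝ} (h : t ≤ 0) : minVal u w t = 0 := if_neg h.not_gt

lemma maxVal_of_neg {t : ℝ} (h : t < 0) : maxVal u w t = 0 := if_neg h.not_ge

lemma maxVal_of_nonneg {t : ℝ} (h : 0 ≤ t) : maxVal u w t = nthEntry u (numLE w t) := if_pos h

lemma minVal_of_pos {t : ℝ} (h : 0 < t) : minVal u w t = nthEntry u (numLT w t + 1) := if_pos h

lemma minVal_nonneg (hu0 : ∀ i, 0 ≤ u i) (t : ℝ) : 0 ≤ minVal u w t := by
  unfold minVal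
  split_ifs
  · exact nthEntry_nonneg hu0 _
  · exact le_rfl

lemma maxVal_nonneg (hu0 : ∀ i, 0 ≤ u i) (t : ℝ) : 0 ≤ maxVal u w t := by
  unfold maxVal
  split_ifs
  · exact nthEntry_nonneg hu0 _
  · exact le_rfl

/-- Together with `minVal_le_maxVal`, which needs a value attained by `ext0 w`, this orders the
intervals along `w` with overlaps at endpoints only. Transitivity of `relOf` and its level structure
rest on it. -/
lemma maxVal_le_minVal (hu0 : ∀ i, 0 ≤ u i) (hu : Monotone u) {s t : ℝ} (h : s < t) :
    maxVal u w s ≤ minVal u w t := by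
  by_cases hs : 0 ≤ s
  · rw [maxVal_of_nonneg hs, minVal_of_pos (hs.trans_lt h)]
    exact nthEntry_mono hu0 hu ((numLE_le_numLT h).trans (Nat.le_succ _))
  · rw [maxVal_of_neg (not_le.1 hs)]
    exact minVal_nonneg hu0 t

lemma minVal_le_maxVal (hu0 : ∀ i, 0 ≤ u i) (hu : Monotone u) (p : Fin (n + 1)) :
    minVal u w (ext0 w p) ≤ maxVal u w (ext0 w p) := by
  by_cases h : 0 < ext0 w p
  · rw [minVal_of_pos h, maxVal_of_nonneg h.le]
    refine nthEntry_mono hu0 hu ?_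
    revert h
    refine Fin.cases (fun h => ?_) (fun i _ => ?_) p
    · simp at h
    · exact numLT_lt_numLE i
  · rw [minVal_of_nonpos (not_lt.1 h)]
    exact maxVal_nonneg hu0 _

lemma relOf_isPreorder (hu0 : ∀ i, 0 ≤ u i) (hu : Monotone u) (w : Fin n → ℝ) :
    IsPreorder _ (relOf u w) where
  refl p := .inl rfl
  trans := by
    rintro p q r (rfl | hpq) (rfl | hqr)
    · exact .inl rfl
    · exact .inr hqr
    · exact .inr hpq
    · refine .inr ⟨hpq.1.trans hqr.1, ?_⟩
      rcases hqr.1.lt_or_eq with h | h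
      · exact hpq.2.trans_le ((maxVal_le_minVal hu0 hu h).trans (minVal_le_maxVal hu0 hu r))
      · rw [← h]; exact hpq.2

lemma relOf_strictFor (u w : Fin n → ℝ) : StrictFor w (relOf u w) := by
  constructor
  · rintro i j (rfl | h)
    · exact le_rfl
    · exact h.1
  · rintro i j (rfl | h) heq
    · exact .inl rfl
    · refine .inr ⟨heq.ge, ?_⟩
      rw [← heq]
      have := h.2
      rwa [← heq] at this

/-- Along a sorting permutation the elements below a threshold occupy an initial segment, so counts
of coordinates turn into positions. -/
lemma lt_numLT_iff {τ : Equiv.Perm (Fin n)} (hτ : Monotone (w ∘ τ)) (t : ℝ) (j : Fin n) :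
    (j : ℕ) < numLT w t ↔ w (τ j) < t := by
  have hc : numLT w t = (Finset.univ.filter fun i => w (τ i) < t).card := by
    refine (Finset.card_equiv τ fun i => ?_).symm
    simp
  rw [hc, ← mem_iff_lt_card]
  · simp
  · intro i j hij hj
    simp only [Finset.mem_filter, Finset.mem_univ, true_and] at hj ⊢
    exact (hτ hij).trans_lt hj

lemma lt_numLE_iff {τ : Equiv.Perm (Fin n)} (hτ : Monotone (w ∘ τ)) (t : ℝ) (j : Fin n) :
    (j : ℕ) < numLE w t ↔ w (τ j) ≤ t := by
  have hc : numLE w t = (Finset.univ.filter fun i => w (τ i) ≤ t).card := by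
    refine (Finset.card_equiv τ fun i => ?_).symm
    simp
  rw [hc, ← mem_iff_lt_card]
  · simp
  · intro i j hij hj
    simp only [Finset.mem_filter, Finset.mem_univ, true_and] at hj ⊢
    exact (hτ hij).trans hj

lemma numLE_le (w : Fin n → ℝ) (t : ℝ) : numLE w t ≤ n :=
  (Finset.card_le_univ _).trans_eq (Fintype.card_fin n)

lemma le_nthEntry_numLE (hu0 : ∀ i, 0 ≤ u i) (hu : Monotone u) {τ : Equiv.Perm (Fin n)}
    (hτ : Monotone (w ∘ τ)) {t : ℝ} {i : Fin n} (h : w i ≤ t) :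
    u (τ.symm i) ≤ nthEntry u (numLE w t) := by
  have : ((τ.symm i : Fin n) : ℕ) < numLE w t := (lt_numLE_iff hτ t _).2 (by simpa using h)
  rw [← nthEntry_succ (u := u) (τ.symm i)]
  exact nthEntry_mono hu0 hu this

lemma nthEntry_numLT_le (hu0 : ∀ i, 0 ≤ u i) (hu : Monotone u) {τ : Equiv.Perm (Fin n)}
    (hτ : Monotone (w ∘ τ)) {t : ℝ} {i : Fin n} (h : t ≤ w i) :
    nthEntry u (numLT w t + 1) ≤ u (τ.symm i) := by
  have : ¬ ((τ.symm i : Fin n) : ℕ) < numLT w t := by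
    rw [lt_numLT_iff hτ]; simpa using h
  rw [← nthEntry_succ (u := u) (τ.symm i)]
  exact nthEntry_mono hu0 hu (by omega)

/-- Placing the entries of `u` in the order of `w` maximizes every functional in the sliced cone
of `relOf u w`. -/
lemma dotProduct_le_place (hu0 : ∀ i, 0 ≤ u i) (hu : Monotone u) {τ : Equiv.Perm (Fin n)}
    (hτ : Monotone (w ∘ τ)) {w' : Fin n → ℝ} (hw' : w' ∈ slicedCone (relOf u w)) {y : Fin n → ℝ}
    (hy : y ∈ PF u) : w' ⬝ᵥ y ≤ w' ⬝ᵥ place u τ {i | 0 < w i} := by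
  classical
  set a := place u τ {i | 0 < w i} with ha
  suffices h : 0 ≤ ∑ i, w' i * (a i - y i) by
    simp only [mul_sub, Finset.sum_sub_distrib] at h
    simpa [dotProduct] using h
  -- Superlevel sets of `w'` at positive height are treated as up-sets of the preorder not
  -- containing 0; on sublevel sets at negative height the placement vanishes.
  refine sum_mul_nonneg_of_level (fun t ht => ?_) fun t ht => ?_
  · set V : Finset (Fin n) := Finset.univ.filter fun i => t ≤ w' i with hV
    have hout : ∀ p ∈ V, ∀ q, relOf u w p.succ q → t ≤ ext0 w' q := by
      intro p hp q hpq
      have h1 : t ≤ w' p := by simpa [hV] using hp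
      exact h1.trans (mem_slicedCone.1 hw' _ _ hpq)
    -- If `V` reaches a coordinate with `w p ≤ 0`, then 0 is not above `p`, since that would give `t
    -- ≤ 0`. Hence all entries of `u` assigned to nonpositive coordinates are zero, and zeroing them
    -- in the placement loses nothing.
    have hzero : ∀ p ∈ V, w p ≤ 0 → nthEntry u (numLE w 0) = 0 := by
      intro p hp hwp
      by_contra hne
      have hpos := (nthEntry_nonneg hu0 (numLE w 0)).lt_of_ne' hne
      have hr : relOf u w p.succ 0 := by
        refine .inr ⟨by simpa using hwp, ?_⟩
        rw [minVal_of_nonpos (by simpa using hwp), maxVal_of_nonneg (by simp)]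
        simpa using hpos
      have := hout p hp _ hr
      simp only [ext0_zero] at this
      linarith
    have haV : ∀ p ∈ V, a p = u (τ.symm p) := by
      intro p hp
      by_cases hwp : 0 < w p
      · exact place_of_mem hwp
      · have h1 : a p = 0 := place_of_notMem hwp
        have h2 := le_nthEntry_numLE hu0 hu hτ (not_lt.1 hwp)
        rw [hzero p hp (not_lt.1 hwp)] at h2
        rw [h1]
        exact le_antisymm (hu0 _) h2
    have hsum : ∑ i ∈ V, a i = ∑ j ∈ V.image τ.symm, u j := by
      rw [Finset.sum_image fun _ _ _ _ h => τ.symm.injective h]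
      exact Finset.sum_congr rfl haV
    rw [Finset.sum_sub_distrib, sub_nonneg, hsum]
    refine sum_le_of_mem_PF hy ?_ ?_
    · rw [Finset.card_image_of_injective _ τ.symm.injective]
    · intro j hj j' hj'
      obtain ⟨p, hp, rfl⟩ := Finset.mem_image.1 hj
      obtain ⟨q, rfl⟩ := τ.symm.surjective j'
      have hq : q ∉ V := fun h => hj' (Finset.mem_image_of_mem _ h)
      -- What must be shown is that `V` received the largest entries of `u`. Only the case `w p ≤ w
      -- q` with `q` outside `V` is critical: there `p` is not below `q`, so the two intervals
      -- cannot be separated.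
      by_cases hlt : w q < w p
      · refine hu (not_lt.1 fun h => ?_)
        have := hτ h.le
        simp only [Function.comp_apply, Equiv.apply_symm_apply] at this
        linarith
      · have hle := not_lt.1 hlt
        have hnr : ¬ relOf u w p.succ q.succ := by
          intro h
          have := hout p hp _ h
          simp only [ext0_succ] at this
          exact hq (by simpa [hV] using this)
        have hm : maxVal u w (w q) ≤ minVal u w (w p) := by
          by_contra hcon
          exact hnr (.inr ⟨by simpa using hle, by simpa using hcon⟩)
        by_cases hq0 : 0 ≤ w q
        · rw [maxVal_of_nonneg hq0] at hm
          refine (le_nthEntry_numLE hu0 hu hτ le_rfl).trans (hm.trans ?_)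
          by_cases hp0 : 0 < w p
          · rw [minVal_of_pos hp0]
            exact nthEntry_numLT_le hu0 hu hτ le_rfl
          · rw [minVal_of_nonpos (not_lt.1 hp0)]
            exact hu0 _
        · have h1 := le_nthEntry_numLE hu0 hu hτ (not_le.1 hq0).le
          rw [hzero p hp (by linarith)] at h1
          exact h1.trans (hu0 _)
  · refine Finset.sum_nonpos fun i hi => ?_
    have hi : w' i ≤ t := by simpa using hi
    have hai : a i = 0 := by
      by_contra hne
      have hwi : 0 < w i := by
        by_contra h
        exact hne (place_of_notMem h)
      have hai : a i = u (τ.symm i) := place_of_mem hwi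
      have hpos : 0 < u (τ.symm i) := by
        rw [← hai]; exact (place_nonneg hu0 _ _ i).lt_of_ne' hne
      -- A positive entry at `i` would put 0 below `i` and force `w' i ≥ 0`.
      have hr : relOf u w 0 i.succ := by
        refine .inr ⟨by simpa using hwi.le, ?_⟩
        rw [minVal_of_nonpos (by simp), maxVal_of_nonneg (by simpa using hwi.le)]
        exact hpos.trans_le (le_nthEntry_numLE hu0 hu hτ le_rfl)
      have := mem_slicedCone.1 hw' _ _ hr
      simp only [ext0_zero, ext0_succ] at this
      linarith
    rw [hai]
    linarith [nonneg_of_mem_PF hy i]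

/-- Coordinates with `w i = 0` contribute nothing, so they may keep their entry of `u` or be set to
zero. This freedom produces the extreme values at those coordinates. -/
lemma place_mem_maxFace (hu0 : ∀ i, 0 ≤ u i) (hu : Monotone u) {τ : Equiv.Perm (Fin n)}
    (hτ : Monotone (w ∘ τ)) {S : Set (Fin n)} (h1 : ∀ i, 0 < w i → i ∈ S)
    (h2 : ∀ i ∈ S, 0 ≤ w i) : place u τ S ∈ maxFace (PF u) w := by
  have heq : w ⬝ᵥ place u τ S = w ⬝ᵥ place u τ {i | 0 < w i} := by
    refine Finset.sum_congr rfl fun i _ => ?_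
    by_cases hi : 0 < w i
    · rw [place_of_mem (h1 i hi), place_of_mem (show i ∈ {i | 0 < w i} from hi)]
    · by_cases hS : i ∈ S
      · have : w i = 0 := le_antisymm (not_lt.1 hi) (h2 i hS)
        simp [this]
      · rw [place_of_notMem hS, place_of_notMem (show i ∉ {i | 0 < w i} from hi)]
  refine ⟨place_mem hu0 hu τ S, fun y hy => ?_⟩
  rw [heq]
  exact dotProduct_le_place hu0 hu hτ (relOf_strictFor u w).1 hy

lemma exists_sorting (w : Fin n → ℝ) : ∃ τ : Equiv.Perm (Fin n), Monotone (w ∘ τ) :=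
  ⟨Tuple.sort w, Tuple.monotone_sort w⟩

end RelOf

/-! ### Normal cones as sliced preorder cones, and their inclusions as contractions. -/

section NormalCone

variable {n : ℕ} {u w : Fin n → ℝ}

lemma monotone_comp_swap {τ : Equiv.Perm (Fin n)} (hτ : Monotone (w ∘ τ)) {j k : Fin n}
    (h : w (τ j) = w (τ k)) : Monotone (w ∘ (Equiv.swap j k).trans τ) := by
  convert hτ using 1
  ext i
  simp only [Function.comp_apply, Equiv.trans_apply]
  rcases eq_or_ne i j with rfl | hij
  · rw [Equiv.swap_apply_left, h]
  · rcases eq_or_ne i k with rfl | hik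
    · rw [Equiv.swap_apply_right, h]
    · rw [Equiv.swap_apply_of_ne_of_ne hij hik]

/-- Some sorting permutation of `w` puts `p` first and `q` last among the coordinates with the
same value of `w`. -/
lemma exists_sorting_extremal (w : Fin n → ℝ) {p q : Fin n} (hpq : p ≠ q) :
    ∃ τ : Equiv.Perm (Fin n), Monotone (w ∘ τ) ∧ (τ.symm p : ℕ) = numLT w (w p) ∧
      (τ.symm q : ℕ) + 1 = numLE w (w q) := by
  obtain ⟨σ, hσ⟩ := exists_sorting w
  have hp1 := numLT_lt_numLE (w := w) p
  have hp2 := numLE_le w (w p)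
  let l : Fin n := ⟨numLT w (w p), by omega⟩
  have hl : w (σ (σ.symm p)) = w (σ l) := by
    have h1 : ¬ w (σ l) < w p := by rw [← lt_numLT_iff hσ]; simp [l]
    have h2 : w (σ l) ≤ w p := by rw [← lt_numLE_iff hσ]; simpa [l] using hp1
    rw [Equiv.apply_symm_apply]
    exact le_antisymm (not_lt.1 h1) h2
  set τ := (Equiv.swap (σ.symm p) l).trans σ with hτ
  have hτm : Monotone (w ∘ τ) := monotone_comp_swap hσ hl
  have hτp : τ l = p := by simp [hτ]
  have hq1 := numLT_lt_numLE (w := w) q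
  have hq2 := numLE_le w (w q)
  let h : Fin n := ⟨numLE w (w q) - 1, by omega⟩
  have hh : w (τ (τ.symm q)) = w (τ h) := by
    have h1 : ¬ w (τ h) < w q := by rw [← lt_numLT_iff hτm]; simp [h]; omega
    have h2 : w (τ h) ≤ w q := by rw [← lt_numLE_iff hτm]; simp [h]; omega
    rw [Equiv.apply_symm_apply]
    exact le_antisymm (not_lt.1 h1) h2
  refine ⟨(Equiv.swap (τ.symm q) h).trans τ, monotone_comp_swap hτm hh, ?_, ?_⟩
  -- The second swap must not move `p`. If the first position for `p` were the last one for `q`, a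
  -- level of `w` with a single element would contain both.
  · have hlh : l ≠ h := by
      intro hlh
      have hw : w p = w q := by
        rw [← hτp, hlh, ← hh, Equiv.apply_symm_apply]
      have hval : numLT w (w p) = numLE w (w q) - 1 := congrArg Fin.val hlh
      have hsub : ({p, q} : Finset (Fin n)) ⊆
          (Finset.univ.filter fun i => w i ≤ w q) \ Finset.univ.filter fun i => w i < w q := by
        intro i hi
        rcases Finset.mem_insert.1 hi with rfl | hi
        · simp [hw]
        · rw [Finset.mem_singleton.1 hi]; simp
      have hc := Finset.card_le_card hsub
      rw [Finset.card_pair hpq, Finset.card_sdiff_of_subset] at hc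
      · change 2 ≤ numLE w (w q) - numLT w (w q) at hc
        rw [hw] at hval
        omega
      · intro i hi
        simp only [Finset.mem_filter, Finset.mem_univ, true_and] at hi ⊢
        exact hi.le
    have hlq : l ≠ τ.symm q := by
      intro hlq
      exact hpq (by rw [← hτp, hlq, Equiv.apply_symm_apply])
    have : ((Equiv.swap (τ.symm q) h).trans τ).symm p = l := by
      rw [Equiv.symm_apply_eq, Equiv.trans_apply, Equiv.swap_apply_of_ne_of_ne hlq hlh, hτp]
    rw [this]
  · have : ((Equiv.swap (τ.symm q) h).trans τ).symm q = h := by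
      rw [Equiv.symm_apply_eq, Equiv.trans_apply, Equiv.swap_apply_right, Equiv.apply_symm_apply]
    rw [this]
    simp only [h]
    omega

/-- If some point of a face of `PF u` given by a placement has a smaller value at `p` than at `q`,
then the functionals of the normal cone are ordered in the same way. -/
lemma le_of_place_lt (hu0 : ∀ i, 0 ≤ u i) (hu : Monotone u) {F : Set (Fin n → ℝ)}
    {w' : Fin n → ℝ} (hw' : w' ∈ normalCone F (PF u)) {τ : Equiv.Perm (Fin n)} {S : Set (Fin n)}
    (hF : place u τ S ∈ F) {p q : Fin n} (h : place u τ S p < place u τ S q) : w' p ≤ w' q := by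
  classical
  set x := place u τ S with hx
  -- Exchanging the two coordinates changes the value of `w'` by `(w' p - w' q) * (x q - x p)`,
  -- which must not be positive.
  have hy : x ∘ Equiv.swap p q ∈ PF u := by
    refine (isParkingFunction_of_perm hu (fun i => place_nonneg hu0 τ S _)
      (τ.trans (Equiv.swap p q)) fun i => ?_).mem
    simp only [Equiv.trans_apply, Equiv.swap_apply_self]
    unfold place
    split_ifs
    · simp
    · exact hu0 i
  have hle := hw' x hF _ hy
  have hpq : p ≠ q := by rintro rfl; exact lt_irrefl _ h
  have hdiff : w' ⬝ᵥ (x ∘ Equiv.swap p q) - w' ⬝ᵥ x = (w' p - w' q) * (x q - x p) := by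
    rw [← dotProduct_sub, dotProduct, ← Finset.add_sum_erase _ _ (Finset.mem_univ p),
      ← Finset.add_sum_erase _ _ (Finset.mem_erase.2 ⟨hpq.symm, Finset.mem_univ q⟩),
      Finset.sum_eq_zero]
    · simp; ring
    · intro i hi
      simp only [Finset.mem_erase, Finset.mem_univ, and_true] at hi
      simp [Equiv.swap_apply_of_ne_of_ne hi.2 hi.1]
  by_contra hcon
  push Not at hcon
  nlinarith [mul_pos (sub_pos.2 hcon) (sub_pos.2 h)]

/-- Raising or lowering one coordinate of a point in a face within the polytope. -/
lemma mul_nonpos_of_add_single {P F : Set (Fin n → ℝ)} {w' x y : Fin n → ℝ}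
    (hw' : w' ∈ normalCone F P) (hx : x ∈ F) (hy : y ∈ P) {p : Fin n}
    (h : ∀ i, i ≠ p → y i = x i) : w' p * (y p - x p) ≤ 0 := by
  classical
  have hle := hw' x hx y hy
  have hdiff : w' ⬝ᵥ y - w' ⬝ᵥ x = w' p * (y p - x p) := by
    rw [← dotProduct_sub, dotProduct, ← Finset.add_sum_erase _ _ (Finset.mem_univ p),
      Finset.sum_eq_zero]
    · simp
    · intro i hi
      simp [h i (Finset.mem_erase.1 hi).1]
  linarith

/-- Each relation is witnessed by a move inside the polytope from a maximizer of `w`. For 0 below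
`q`, lower `q` from its largest value to 0; for `p` below 0, raise `p` from 0 to a positive value;
for `p` below `q`, exchange them at a maximizer where `p` is least and `q` is largest. -/
lemma normalCone_subset_slicedCone (hu0 : ∀ i, 0 ≤ u i) (hu : Monotone u) (w : Fin n → ℝ) :
    normalCone (maxFace (PF u) w) (PF u) ⊆ slicedCone (relOf u w) := by
  intro w' hw'
  rw [mem_slicedCone]
  rintro p q (rfl | ⟨hle, hlt⟩)
  · exact le_rfl
  induction p using Fin.cases with
  | zero =>
    induction q using Fin.cases with
    | zero => exact le_rfl
    | succ q =>
      simp only [ext0_zero, ext0_succ] at hle hlt ⊢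
      obtain ⟨τ, hτ⟩ := exists_sorting w
      rw [minVal_of_nonpos le_rfl, maxVal_of_nonneg hle] at hlt
      have hK := numLT_lt_numLE (w := w) q
      have hKn := numLE_le w (w q)
      let h : Fin n := ⟨numLE w (w q) - 1, by omega⟩
      have hh : w (τ (τ.symm q)) = w (τ h) := by
        have h1 : ¬ w (τ h) < w q := by rw [← lt_numLT_iff hτ]; simp [h]; omega
        have h2 : w (τ h) ≤ w q := by rw [← lt_numLE_iff hτ]; simp [h]; omega
        rw [Equiv.apply_symm_apply]
        exact le_antisymm (not_lt.1 h1) h2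
      set τ' := (Equiv.swap (τ.symm q) h).trans τ with hτ'
      have hmem := place_mem_maxFace hu0 hu (monotone_comp_swap hτ hh) (S := {i | 0 ≤ w i})
        (fun i hi => le_of_lt hi) (fun i hi => hi)
      have hval : place u τ' {i | 0 ≤ w i} q = nthEntry u (numLE w (w q)) := by
        have : τ'.symm q = h := by
          rw [Equiv.symm_apply_eq, hτ', Equiv.trans_apply, Equiv.swap_apply_right,
            Equiv.apply_symm_apply]
        rw [place_of_mem (show q ∈ {i | 0 ≤ w i} from hle), this, ← nthEntry_succ (u := u) h]
        congr 1
        simp only [h]; omega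
      have := mul_nonpos_of_add_single hw' hmem
        (place_mem hu0 hu τ' ({i | 0 ≤ w i} \ {q})) (p := q) (by
          intro i hi
          by_cases hwi : 0 ≤ w i
          · rw [place_of_mem (show i ∈ {i | 0 ≤ w i} from hwi), 
              place_of_mem (show i ∈ {i | 0 ≤ w i} \ {q} from ⟨hwi, hi⟩)]
          · rw [place_of_notMem (show i ∉ {i | 0 ≤ w i} from hwi),
              place_of_notMem (fun h => hwi h.1)])
      rw [hval, place_of_notMem (fun h => h.2 rfl)] at this
      nlinarith
  | succ p =>
    induction q using Fin.cases with
    | zero =>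
      simp only [ext0_zero, ext0_succ] at hle hlt ⊢
      obtain ⟨τ, hτ⟩ := exists_sorting w
      rw [minVal_of_nonpos hle, maxVal_of_nonneg le_rfl] at hlt
      have hK : numLE w 0 ≠ 0 := by
        intro h0
        rw [h0, nthEntry_zero] at hlt
        exact lt_irrefl _ hlt
      have hKn := numLE_le w 0
      let h : Fin n := ⟨numLE w 0 - 1, by omega⟩
      have hh : w (τ h) ≤ 0 := by rw [← lt_numLE_iff hτ]; simp [h]; omega
      -- The coordinate that trades positions with `p` has `w ≤ 0` and is zero in both placements
      -- unless it is `p` itself, so only the entry at `p` changes.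
      set τ' := (Equiv.swap (τ.symm p) h).trans τ with hτ'
      have hmem := place_mem_maxFace hu0 hu hτ (S := {i | 0 < w i})
        (fun i hi => hi) (fun i hi => le_of_lt hi)
      have hval : place u τ' ({i | 0 < w i} ∪ {p}) p = nthEntry u (numLE w 0) := by
        have : τ'.symm p = h := by
          rw [Equiv.symm_apply_eq, hτ', Equiv.trans_apply, Equiv.swap_apply_right,
            Equiv.apply_symm_apply]
        rw [place_of_mem (.inr rfl), this, ← nthEntry_succ (u := u) h]
        congr 1
        simp only [h]; omega
      have := mul_nonpos_of_add_single hw' hmem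
        (place_mem hu0 hu τ' ({i | 0 < w i} ∪ {p})) (p := p) (by
          intro i hi
          by_cases hwi : 0 < w i
          · rw [place_of_mem (show i ∈ {i | 0 < w i} from hwi), place_of_mem (.inl hwi)]
            congr 1
            rw [Equiv.symm_apply_eq, hτ', Equiv.trans_apply, Equiv.swap_apply_of_ne_of_ne,
              Equiv.apply_symm_apply]
            · exact fun h' => hi (τ.symm.injective h')
            · intro h'
              rw [← h', Equiv.apply_symm_apply] at hh
              linarith
          · rw [place_of_notMem (show i ∉ {i | 0 < w i} from hwi),
              place_of_notMem (fun h => h.elim hwi hi)])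
      rw [hval, place_of_notMem (show p ∉ {i | 0 < w i} from not_lt.2 hle)] at this
      nlinarith
    | succ q =>
      simp only [ext0_succ] at hle hlt ⊢
      rcases eq_or_ne p q with rfl | hpq
      · exact le_rfl
      have hq0 : 0 ≤ w q := by
        by_contra h
        rw [maxVal_of_neg (not_le.1 h)] at hlt
        exact absurd hlt (minVal_nonneg hu0 _).not_gt
      obtain ⟨τ, hτ, hp, hq⟩ := exists_sorting_extremal w hpq
      -- Among the coordinates with `w = 0` only `p` is zeroed, which gives `p` its minimum while
      -- `q` keeps its maximum.
      have hmem := place_mem_maxFace hu0 hu hτ (S := {i | 0 < w i} ∪ ({i | w i = 0} \ {p}))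
        (fun i hi => .inl hi) (fun i hi => hi.elim (fun h => le_of_lt h) fun h => h.1.ge)
      refine le_of_place_lt hu0 hu hw' hmem ?_
      have hqS : q ∈ {i | 0 < w i} ∪ ({i | w i = 0} \ {p}) := by
        rcases hq0.lt_or_eq with h | h
        · exact .inl h
        · exact .inr ⟨h.symm, hpq.symm⟩
      rw [maxVal_of_nonneg hq0, ← hq, nthEntry_succ] at hlt
      rw [place_of_mem hqS]
      refine lt_of_le_of_lt ?_ hlt
      by_cases hp0 : 0 < w p
      · rw [place_of_mem (.inl hp0), minVal_of_pos hp0, ← hp, nthEntry_succ]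
      · rw [place_of_notMem (fun h => h.elim hp0 fun h => h.2 rfl)]
        exact minVal_nonneg hu0 _

/-- For small `ε` both `w'` and `w - ε • w'` lie in the cone, so the greedy placement maximizes
both. A maximizer of `w` can then fall short for neither. -/
lemma slicedCone_subset_normalCone (hu0 : ∀ i, 0 ≤ u i) (hu : Monotone u) (w : Fin n → ℝ) :
    slicedCone (relOf u w) ⊆ normalCone (maxFace (PF u) w) (PF u) := by
  intro w' hw'
  obtain ⟨τ, hτ⟩ := exists_sorting w
  obtain ⟨ε, hε, hmem⟩ := exists_sub_smul_mem (relOf_strictFor u w).1 (w' := w')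
    fun i j hij heq => mem_slicedCone.1 hw' _ _ ((relOf_strictFor u w).2 i j hij heq)
  intro x hx y hy
  have h1 := dotProduct_le_place hu0 hu hτ hw' hy
  have h2 := dotProduct_le_place hu0 hu hτ hmem hx.1
  have h3 := hx.2 _ (place_mem hu0 hu τ {i | 0 < w i})
  simp only [sub_dotProduct, smul_dotProduct, smul_eq_mul] at h2
  nlinarith

theorem normalCone_maxFace_eq (hu0 : ∀ i, 0 ≤ u i) (hu : Monotone u) (w : Fin n → ℝ) :
    normalCone (maxFace (PF u) w) (PF u) = slicedCone (relOf u w) :=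
  (normalCone_subset_slicedCone hu0 hu w).antisymm (slicedCone_subset_normalCone hu0 hu w)

lemma maxFace_nonempty (hu0 : ∀ i, 0 ≤ u i) (hu : Monotone u) (w : Fin n → ℝ) :
    (maxFace (PF u) w).Nonempty := by
  obtain ⟨τ, hτ⟩ := exists_sorting w
  exact ⟨_, place_mem_maxFace hu0 hu hτ (S := {i | 0 < w i}) (fun i hi => hi)
    (fun i hi => le_of_lt hi)⟩

lemma mem_normalFan_iff (hu0 : ∀ i, 0 ≤ u i) (hu : Monotone u) (σ : Set (Fin n → ℝ)) :
    σ ∈ normalFan (PF u) ↔ ∃ w, σ = slicedCone (relOf u w) := by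
  constructor
  · rintro ⟨F, ⟨-, w, rfl⟩, rfl⟩
    exact ⟨w, normalCone_maxFace_eq hu0 hu w⟩
  · rintro ⟨w, rfl⟩
    exact ⟨maxFace (PF u) w, ⟨maxFace_nonempty hu0 hu w, w, rfl⟩,
      (normalCone_maxFace_eq hu0 hu w).symm⟩

/-- The preorder of a functional in a cone of the normal fan arises by merging along the ties of
the functional. -/
lemma relOf_eq_reflTransGen (hu0 : ∀ i, 0 ≤ u i) (hu : Monotone u) {w₀ w : Fin n → ℝ}
    (hw : w ∈ slicedCone (relOf u w₀)) :
    relOf u w = Relation.ReflTransGen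
      (fun x y => relOf u w₀ x y ∨ (relOf u w₀ y x ∧ ext0 w x = ext0 w y)) := by
  set G := Relation.ReflTransGen
      (fun x y => relOf u w₀ x y ∨ (relOf u w₀ y x ∧ ext0 w x = ext0 w y)) with hG
  have : IsPreorder _ G := { refl := fun _ => .refl, trans := fun _ _ _ => .trans }
  have := relOf_isPreorder hu0 hu w
  -- The cone of `G` is the face of the cone of `relOf u w₀` on which the ties of `w` become
  -- equalities.
  have hmemG : ∀ w', w' ∈ slicedCone G ↔ w' ∈ slicedCone (relOf u w₀) ∧
      ∀ i j, relOf u w₀ i j → ext0 w i = ext0 w j → ext0 w' j ≤ ext0 w' i := by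
    intro w'
    constructor
    · intro h
      exact ⟨fun i j hij => h i j (.single (.inl hij)),
        fun i j hij heq => h j i (.single (.inr ⟨hij, heq.symm⟩))⟩
    · rintro ⟨h1, h2⟩ i j hij
      change ext0 w' i ≤ ext0 w' j
      induction hij with
      | refl => exact le_rfl
      | tail _ h ih =>
        refine ih.trans ?_
        rcases h with h | h
        · exact h1 _ _ h
        · exact h2 _ _ h.1 h.2.symm
  refine eq_of_slicedCone_eq (Set.Subset.antisymm ?_ ?_)
  · intro w' hw'
    rw [hmemG]
    obtain ⟨ε, hε, hmem⟩ := exists_sub_smul_mem (relOf_strictFor u w).1 (w' := w')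
      fun i j hij heq => mem_slicedCone.1 hw' _ _ ((relOf_strictFor u w).2 i j hij heq)
    have hsub : slicedCone (relOf u w) ⊆ slicedCone (relOf u w₀) := by
      rw [← normalCone_maxFace_eq hu0 hu, ← normalCone_maxFace_eq hu0 hu, normalCone_subset_iff]
      · intro x hx
        rw [← normalCone_maxFace_eq hu0 hu] at hw
        exact ⟨hx.1, hw x hx⟩
      · exact ⟨w₀, rfl⟩
      · exact ⟨w, rfl⟩
    refine ⟨hsub hw', fun i j hij heq => ?_⟩
    have h1 := mem_slicedCone.1 (hsub hmem) i j hij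
    have hext : ∀ p, ext0 (w - ε • w') p = ext0 w p - ε * ext0 w' p := by
      intro p
      refine Fin.cases ?_ (fun i => ?_) p <;> simp
    rw [hext, hext, heq] at h1
    nlinarith
  · intro w' hw'
    obtain ⟨h1, h2⟩ := (hmemG w').1 hw'
    obtain ⟨ε, hε, hmem⟩ := exists_sub_smul_mem hw h2
    rw [← normalCone_maxFace_eq hu0 hu] at h1 hmem ⊢
    exact mem_normalCone_maxFace_of_sub (maxFace_nonempty hu0 hu w₀) hε h1 hmem

/-- Inclusion of cones of the normal fan is contraction of preorders. -/
lemma isContraction_relOf (hu0 : ∀ i, 0 ≤ u i) (hu : Monotone u) {w₀ w : Fin n → ℝ}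
    (hw : w ∈ slicedCone (relOf u w₀)) : IsContraction (relOf u w) (relOf u w₀) := by
  have := relOf_isPreorder hu0 hu w
  have := relOf_isPreorder hu0 hu w₀
  have heq := relOf_eq_reflTransGen hu0 hu hw
  have hle : relOf u w₀ ≤ relOf u w := by
    intro x y h
    rw [heq]
    exact .single (.inl h)
  refine GeneratedByReversals.isContraction ⟨hle, fun x y h => ?_⟩
  rw [heq] at h
  refine Relation.ReflTransGen.mono (fun a b hab => ?_) _ _ h
  rcases hab with hab | hab
  · exact .inl hab
  · refine .inr ⟨hab.1, ?_⟩
    rw [heq]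
    exact .single (.inr hab)

/-- Contractions of preorders in the family `relOf u` stay in the family. -/
lemma exists_relOf_eq_of_isContraction (hu0 : ∀ i, 0 ≤ u i) (hu : Monotone u) {w₀ : Fin n → ℝ}
    {s : Fin (n + 1) → Fin (n + 1) → Prop} (h : IsContraction s (relOf u w₀)) :
    ∃ w, s = relOf u w := by
  have := relOf_isPreorder hu0 hu w₀
  obtain ⟨hs, hle, hgen⟩ := h.generatedByReversals
  -- For a relative interior point `w` of the cone of `s`, the pairs of `relOf u w₀` tied by `w` are
  -- exactly those reversed in `s`.
  obtain ⟨w, hw, hstrict⟩ := exists_strictFor s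
  refine ⟨w, ?_⟩
  rw [relOf_eq_reflTransGen hu0 hu (slicedCone_anti hle hw)]
  refine le_antisymm (fun x y hxy => ?_) (fun x y hxy => ?_)
  · refine Relation.ReflTransGen.mono (fun a b hab => ?_) _ _ (hgen x y hxy)
    rcases hab with hab | hab
    · exact .inl hab
    · exact .inr ⟨hab.1, le_antisymm (hw _ _ hab.2) (hw _ _ (hle _ _ hab.1))⟩
  · induction hxy with
    | refl => exact refl_of s x
    | tail _ h ih =>
      refine trans_of s ih ?_
      rcases h with h | h
      · exact hle _ _ h
      · exact hstrict _ _ (hle _ _ h.1) h.2.symm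

end NormalCone

/-! ### Recovering a skewed binary partition from its preorder, and constructing one from levels. -/

namespace SkewedBinaryPartition

variable {n : ℕ}

/-- The index of the block containing `p`. -/
noncomputable def idx (B : SkewedBinaryPartition n) (p : Fin (n + 1)) : Fin (B.k + 2) :=
  (B.cover p).choose

lemma mem_block_idx (B : SkewedBinaryPartition n) (p : Fin (n + 1)) : p ∈ B.block (B.idx p) :=
  (B.cover p).choose_spec

lemma mem_block_iff (B : SkewedBinaryPartition n) {p : Fin (n + 1)} {i : Fin (B.k + 2)} :
    p ∈ B.block i ↔ B.idx p = i := by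
  constructor
  · intro h
    by_contra hne
    exact Finset.disjoint_left.1 (B.disjoint _ _ hne) (B.mem_block_idx p) h
  · rintro rfl
    exact B.mem_block_idx p

lemma rel_iff (B : SkewedBinaryPartition n) {p q : Fin (n + 1)} :
    B.rel p q ↔ p = q ∨ B.idx p < B.idx q ∨ (B.idx p = B.idx q ∧ B.homog (B.idx p) = true) := by
  unfold rel
  simp only [mem_block_iff]
  constructor
  · rintro (h | ⟨i, j, rfl, rfl, h⟩)
    · exact .inl h
    · exact .inr h
  · rintro (h | h)
    · exact .inl h
    · exact .inr ⟨_, _, rfl, rfl, h⟩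

lemma rel_isPreorder (B : SkewedBinaryPartition n) : IsPreorder _ B.rel where
  refl p := .inl rfl
  trans p q r hpq hqr := by
    rw [rel_iff] at *
    rcases hpq with rfl | hpq | hpq
    · exact hqr
    · rcases hqr with rfl | hqr | hqr
      · exact .inr (.inl hpq)
      · exact .inr (.inl (hpq.trans hqr))
      · exact .inr (.inl (hqr.1 ▸ hpq))
    · rcases hqr with rfl | hqr | hqr
      · exact .inr (.inr hpq)
      · exact .inr (.inl (hpq.1 ▸ hqr))
      · exact .inr (.inr ⟨hpq.1.trans hqr.1, hpq.2⟩)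

lemma idx_lt_iff (B : SkewedBinaryPartition n) {p q : Fin (n + 1)} :
    B.idx p < B.idx q ↔ B.rel p q ∧ ¬ B.rel q p := by
  rw [rel_iff, rel_iff]
  constructor
  · intro h
    refine ⟨.inr (.inl h), ?_⟩
    rintro (rfl | h' | h')
    · exact lt_irrefl _ h
    · exact lt_asymm h h'
    · exact h.ne' h'.1
  · rintro ⟨rfl | h | h, h'⟩
    · exact absurd (.inl rfl) h'
    · exact h
    · exact absurd (.inr (.inr ⟨h.1.symm, h.1 ▸ h.2⟩)) h'

lemma idx_zero (B : SkewedBinaryPartition n) : B.idx 0 = 0 ∨ B.idx 0 = 1 := by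
  simpa only [mem_block_iff] using B.zero_mem

/-- If 0 lies in the first block, the second is empty, so index 1 never occurs strictly above 0.
This makes the indices from 2 on visible in the preorder. -/
lemma two_le_idx_iff (B : SkewedBinaryPartition n) (p : Fin (n + 1)) :
    2 ≤ (B.idx p : ℕ) ↔ B.idx 0 < B.idx p := by
  have h1v : ((1 : Fin (B.k + 2)) : ℕ) = 1 := rfl
  rw [Fin.lt_def]
  rcases B.idx_zero with h | h
  · have hne : B.idx p ≠ 1 := by
      intro hp
      have := (B.of_zero_mem_first (B.mem_block_iff.2 h)).2
      have hm := B.mem_block_iff.2 hp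
      rw [this] at hm
      simp at hm
    have hne' : (B.idx p : ℕ) ≠ 1 := fun h' => hne (Fin.ext h')
    rw [h, Fin.val_zero]
    omega
  · rw [h, h1v]
    omega

/-- In the first block 0 has a companion and the block is not homogeneous, so 0 is incomparable to
something; in the second block any companion is equivalent to 0. The conventions on B_{-1} and B_0
are what make the two cases distinguishable. -/
lemma idx_zero_eq_zero_iff (B : SkewedBinaryPartition n) :
    B.idx 0 = 0 ↔ ∃ p, ¬ B.rel p 0 ∧ ¬ B.rel 0 p := by
  constructor
  · intro h
    obtain ⟨hc, -⟩ := B.of_zero_mem_first (B.mem_block_iff.2 h)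
    obtain ⟨p, hp, hp0⟩ := Finset.exists_mem_ne (lt_of_lt_of_le one_lt_two hc) 0
    have hp : B.idx p = 0 := B.mem_block_iff.1 hp
    refine ⟨p, ?_, ?_⟩ <;> rw [rel_iff] <;> simp [h, hp, hp0, hp0.symm, B.homog_first]
  · rintro ⟨p, h1, h2⟩
    rcases B.idx_zero with h | h
    · exact h
    · rw [rel_iff] at h1 h2
      push Not at h1 h2
      have heq : B.idx p = B.idx 0 := le_antisymm h2.2.1 h1.2.1
      have hc : 2 ≤ (B.block 1).card := by
        have : ({p, 0} : Finset (Fin (n + 1))) ⊆ B.block 1 := by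
          intro x hx
          rw [mem_block_iff]
          rcases Finset.mem_insert.1 hx with rfl | hx
          · rw [heq, h]
          · rw [Finset.mem_singleton.1 hx, h]
        have := Finset.card_le_card this
        rwa [Finset.card_pair h1.1] at this
      exact absurd (h ▸ B.homog_second hc) (h2.2.2 heq.symm)

lemma exists_idx_eq (B : SkewedBinaryPartition n) (i : ℕ) (hi : i < B.k) :
    ∃ p, (B.idx p : ℕ) = i + 2 := by
  obtain ⟨p, hp⟩ := B.nonempty ⟨i, hi⟩
  exact ⟨p, by rw [B.mem_block_iff.1 hp]; simp⟩

/-- Blocks from index 2 on are nonempty, so one can climb a chain one block at a time, and the index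
in `B'` must grow at each step. Symmetry then gives equality. -/
lemma idx_le_of_rel_eq {B B' : SkewedBinaryPartition n} (h : B.rel = B'.rel) (i : ℕ) :
    ∀ p, (B.idx p : ℕ) = i + 2 → i + 2 ≤ (B'.idx p : ℕ) := by
  induction i with
  | zero =>
    intro p hp
    have h1 := (B.two_le_idx_iff p).1 hp.ge
    rw [idx_lt_iff, h, ← idx_lt_iff, ← two_le_idx_iff] at h1
    exact h1
  | succ i ih =>
    intro p hp
    obtain ⟨q, hq⟩ := B.exists_idx_eq i (by have := (B.idx p).2; omega)
    have h1 : B.idx q < B.idx p := by rw [Fin.lt_def]; omega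
    rw [idx_lt_iff, h, ← idx_lt_iff, Fin.lt_def] at h1
    have := ih q hq
    omega

lemma k_le_of_rel_eq {B B' : SkewedBinaryPartition n} (h : B.rel = B'.rel) : B.k ≤ B'.k := by
  by_contra hcon
  obtain ⟨p, hp⟩ := B.exists_idx_eq (B.k - 1) (by omega)
  have := idx_le_of_rel_eq h _ p hp
  have := (B'.idx p).2
  omega

lemma idx_eq_of_rel_eq {B B' : SkewedBinaryPartition n} (h : B.rel = B'.rel)
    (p : Fin (n + 1)) : (B.idx p : ℕ) = B'.idx p := by
  have hzero : (B.idx 0 : ℕ) = B'.idx 0 := by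
    have h0 := B.idx_zero_eq_zero_iff
    rw [h, ← idx_zero_eq_zero_iff] at h0
    rcases B.idx_zero with hB | hB
    · rw [hB, h0.1 hB]; rfl
    · rcases B'.idx_zero with hB' | hB'
      · rw [h0.2 hB'] at hB; simp at hB
      · rw [hB, hB']; rfl
  have hiff : 2 ≤ (B.idx p : ℕ) ↔ 2 ≤ (B'.idx p : ℕ) := by
    rw [two_le_idx_iff, two_le_idx_iff, idx_lt_iff, idx_lt_iff, h]
  by_cases h2 : 2 ≤ (B.idx p : ℕ)
  · have h2' := hiff.1 h2
    have h3 := idx_le_of_rel_eq h ((B.idx p : ℕ) - 2) p (by omega)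
    have h4 := idx_le_of_rel_eq h.symm ((B'.idx p : ℕ) - 2) p (by omega)
    omega
  · have h2' : ¬ 2 ≤ (B'.idx p : ℕ) := fun h' => h2 (hiff.2 h')
    -- Only the indices 0 and 1 remain, and comparison with the index of 0 separates them.
    have hlt : B.idx p < B.idx 0 ↔ B'.idx p < B'.idx 0 := by
      rw [idx_lt_iff, idx_lt_iff, h]
    have hgt : B.idx 0 < B.idx p ↔ B'.idx 0 < B'.idx p := by
      rw [idx_lt_iff, idx_lt_iff, h]
    have h0 : (B.idx 0 : ℕ) ≤ 1 := by
      rcases B.idx_zero with hB | hB <;> rw [hB]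
      · exact zero_le_one
      · exact le_rfl
    rw [Fin.lt_def, Fin.lt_def] at hlt hgt
    omega

lemma homog_iff (B : SkewedBinaryPartition n) (i : Fin (B.k + 2)) :
    B.homog i = true ↔ ∃ p q, p ≠ q ∧ B.idx p = i ∧ B.idx q = i ∧ B.rel p q := by
  constructor
  · intro h
    obtain ⟨p, hp, q, hq, hpq⟩ := Finset.one_lt_card.1 (B.two_le_of_homog i h)
    rw [mem_block_iff] at hp hq
    exact ⟨p, q, hpq, hp, hq, B.rel_iff.2 (.inr (.inr ⟨hp.trans hq.symm, hp ▸ h⟩))⟩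
  · rintro ⟨p, q, hpq, rfl, hq, h⟩
    rcases B.rel_iff.1 h with h | h | h
    · exact absurd h hpq
    · exact absurd hq h.ne'
    · exact h.2

/-- A skewed binary partition is determined by its preorder. -/
theorem rel_injective : Function.Injective (rel : SkewedBinaryPartition n → _) := by
  intro B B' h
  have hk := le_antisymm (k_le_of_rel_eq h) (k_le_of_rel_eq h.symm)
  have hidx := idx_eq_of_rel_eq h
  have hb : ∀ (i : Fin (B.k + 2)) (i' : Fin (B'.k + 2)), (i : ℕ) = (i' : ℕ) →
      B.block i = B'.block i' := by
    intro i i' hi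
    ext p
    rw [mem_block_iff, mem_block_iff, Fin.ext_iff, Fin.ext_iff, hidx, hi]
  have hh : ∀ (i : Fin (B.k + 2)) (i' : Fin (B'.k + 2)), (i : ℕ) = (i' : ℕ) →
      B.homog i = B'.homog i' := by
    intro i i' hi
    rw [Bool.eq_iff_iff, homog_iff, homog_iff]
    simp only [Fin.ext_iff, hidx, hi, h]
  cases B
  cases B'
  dsimp only at hk hb hh
  subst hk
  congr
  · funext i; exact hb i i rfl
  · funext i; exact hh i i rfl

/-- A skewed binary partition with prescribed levels and homogeneity. -/
lemma exists_of_levels (f : Fin (n + 1) → ℝ) (H : Fin (n + 1) → Prop)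
    (hH : ∀ p q, f p = f q → H p → H q) (hbelow : ∀ p q, f p < f 0 → f q < f 0 → f p = f q)
    (hbelowH : ∀ p, f p < f 0 → ¬ H p) (hmin : ¬ H 0 → ∀ p, f 0 ≤ f p) :
    ∃ B : SkewedBinaryPartition n,
      ∀ p q, B.rel p q ↔ p = q ∨ f p < f q ∨ (f p = f q ∧ H p) := by
  classical
  set T : Finset ℝ := (Finset.univ.image f).filter (f 0 < ·) with hT
  have hmemT : ∀ p, f 0 < f p → f p ∈ T := fun p hp =>
    Finset.mem_filter.2 ⟨Finset.mem_image_of_mem _ (Finset.mem_univ p), hp⟩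
  let iso := T.orderIsoOfFin rfl
  -- This decides whether the level of 0 becomes B_0, at index 1, or B_{-1}, at index 0: a level
  -- that is not homogeneous and has further elements must be B_{-1}.
  let alone : Prop := H 0 ∨ ∀ p, f p = f 0 → p = 0
  let g : Fin (n + 1) → Fin (T.card + 2) := fun p =>
    if h : f 0 < f p then (iso.symm ⟨f p, hmemT p h⟩).succ.succ
    else if f p = f 0 ∧ alone then 1 else 0
  have gpos : ∀ p (h : f 0 < f p), g p = (iso.symm ⟨f p, hmemT p h⟩).succ.succ :=
    fun p h => dif_pos h
  have gone : ∀ p, f p = f 0 → alone → g p = 1 := fun p h h' => by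
    simp only [g]; rw [dif_neg h.not_gt, if_pos ⟨h, h'⟩]
  have gzero : ∀ p, f p ≤ f 0 → ¬ (f p = f 0 ∧ alone) → g p = 0 := fun p h h' => by
    simp only [g]; rw [dif_neg h.not_gt, if_neg h']
  have hval1 : ((1 : Fin (T.card + 2)) : ℕ) = 1 := rfl
  have gle : ∀ p, f p ≤ f 0 → (g p : ℕ) ≤ 1 := fun p h => by
    by_cases h' : f p = f 0 ∧ alone
    · rw [gone p h'.1 h'.2, hval1]
    · rw [gzero p h h']; simp
  have geq : ∀ p q, f p = f q → g p = g q := by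
    intro p q h
    simp only [g, h]
  have glt : ∀ p q, f p < f q → g p < g q := by
    intro p q h
    by_cases hq : f 0 < f q
    · rw [gpos q hq]
      by_cases hp : f 0 < f p
      · rw [gpos p hp, Fin.succ_lt_succ_iff, Fin.succ_lt_succ_iff]
        exact iso.symm.strictMono h
      · rw [Fin.lt_def]
        have := gle p (not_lt.1 hp)
        simp only [Fin.val_succ]
        omega
    · have hp : f p < f 0 := h.trans_le (not_lt.1 hq)
      -- An element below 0 forces the level of 0 to be homogeneous, so it takes index 1 and leaves
      -- index 0 free.
      have hone : alone := .inl (by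
        by_contra h0
        exact absurd hp (hmin h0 p).not_gt)
      rcases (not_lt.1 hq).lt_or_eq with hq' | hq'
      · exact absurd (hbelow p q hp hq') h.ne
      · rw [gone q hq' hone, gzero p hp.le fun h' => hp.ne h'.1, Fin.lt_def]
        simp
  have geq_iff : ∀ p q, g p = g q ↔ f p = f q := by
    intro p q
    refine ⟨fun h => ?_, geq p q⟩
    rcases lt_trichotomy (f p) (f q) with h' | h' | h'
    · exact absurd h (glt _ _ h').ne
    · exact h'
    · exact absurd h (glt _ _ h').ne'
  have glt_iff : ∀ p q, g p < g q ↔ f p < f q := by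
    intro p q
    refine ⟨fun h => ?_, glt p q⟩
    rcases lt_trichotomy (f p) (f q) with h' | h' | h'
    · exact h'
    · exact absurd (geq _ _ h') h.ne
    · exact absurd (glt _ _ h') h.not_gt
  have gone' : ∀ p, g p = 1 → f p = f 0 ∧ alone := by
    intro p hp
    by_contra hcon
    by_cases h : f 0 < f p
    · rw [gpos p h, Fin.ext_iff, hval1] at hp
      simp at hp
    · rw [gzero p (not_lt.1 h) hcon, Fin.ext_iff, hval1] at hp
      simp at hp
  let blk : Fin (T.card + 2) → Finset (Fin (n + 1)) := fun i => Finset.univ.filter (g · = i)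
  have hblk : ∀ p i, p ∈ blk i ↔ g p = i := fun p i => by simp [blk]
  have hcard : ∀ p q, p ≠ q → g p = g q → 2 ≤ (blk (g p)).card := fun p q hpq h => by
    have hsub : ({p, q} : Finset (Fin (n + 1))) ⊆ blk (g p) := by
      intro x hx
      rw [hblk]
      rcases Finset.mem_insert.1 hx with rfl | hx
      · rfl
      · rw [Finset.mem_singleton.1 hx, h]
    have := Finset.card_le_card hsub
    rwa [Finset.card_pair hpq] at this
  let B : SkewedBinaryPartition n :=
    { k := T.card
      block := blk
      homog := fun i => decide (2 ≤ (blk i).card ∧ ∃ p, g p = i ∧ H p)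
      disjoint := fun i j hij => Finset.disjoint_left.2 fun p hi hj =>
        hij (((hblk p i).1 hi).symm.trans ((hblk p j).1 hj))
      cover := fun p => ⟨g p, (hblk p _).2 rfl⟩
      homog_first := by
        rw [decide_eq_false_iff_not]
        rintro ⟨-, p, hp, hHp⟩
        have hle : f p ≤ f 0 := by
          by_contra h
          rw [gpos p (not_le.1 h), Fin.ext_iff] at hp
          simp at hp
        rcases hle.lt_or_eq with h | h
        · exact hbelowH p h hHp
        · rw [gone p h (.inl (hH p 0 h hHp)), Fin.ext_iff, hval1] at hp
          simp at hp
      homog_second := fun hc => by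
        rw [decide_eq_true_iff]
        refine ⟨hc, ?_⟩
        obtain ⟨p, hp, q, hq, hpq⟩ := Finset.one_lt_card.1 hc
        rw [hblk] at hp hq
        obtain ⟨hp1, hp2⟩ := gone' p hp
        obtain ⟨hq1, -⟩ := gone' q hq
        refine ⟨p, hp, ?_⟩
        rcases hp2 with h | h
        · exact hH 0 p hp1.symm h
        · exact absurd ((h p hp1).trans (h q hq1).symm) hpq
      zero_mem := by
        rw [hblk, hblk]
        by_cases h : alone
        · exact .inr (gone 0 rfl h)
        · exact .inl (gzero 0 le_rfl fun h' => h h'.2)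
      of_zero_mem_first := fun h => by
        rw [hblk] at h
        have hnot : ¬ alone := by
          intro h'
          rw [gone 0 rfl h', Fin.ext_iff, hval1] at h
          simp at h
        constructor
        · have h2 : ¬ ∀ p, f p = f 0 → p = 0 := fun h' => hnot (.inr h')
          push Not at h2
          obtain ⟨p, hp, hp0⟩ := h2
          rw [← h]
          exact hcard 0 p hp0.symm (geq _ _ hp.symm)
        · rw [Finset.eq_empty_iff_forall_notMem]
          intro p hp
          rw [hblk] at hp
          exact hnot (gone' p hp).2
      two_le_of_homog := fun i h => (decide_eq_true_iff.1 h).1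
      nonempty := fun i => by
        obtain ⟨hx, hx'⟩ := Finset.mem_filter.1 (iso i).2
        obtain ⟨p, -, hp⟩ := Finset.mem_image.1 hx
        refine ⟨p, (hblk p _).2 ?_⟩
        have h : f 0 < f p := by rw [hp]; exact hx'
        rw [gpos p h]
        congr 2
        rw [OrderIso.symm_apply_eq]
        exact Subtype.ext hp }
  have hidx : ∀ p, B.idx p = g p := fun p => B.mem_block_iff.1 ((hblk p _).2 rfl)
  refine ⟨B, fun p q => ?_⟩
  rw [B.rel_iff, hidx, hidx, glt_iff, geq_iff]
  constructor
  · rintro (h | h | ⟨h, h'⟩)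
    · exact .inl h
    · exact .inr (.inl h)
    · obtain ⟨-, r, hr, hHr⟩ := decide_eq_true_iff.1 h'
      exact .inr (.inr ⟨h, hH r p ((geq_iff r p).1 hr) hHr⟩)
  · rintro (h | h | ⟨h, h'⟩)
    · exact .inl h
    · exact .inr (.inl h)
    · rcases eq_or_ne p q with hpq | hpq
      · exact .inl hpq
      · exact .inr (.inr ⟨h, decide_eq_true_iff.2 ⟨hcard p q hpq (geq _ _ h), p, rfl, h'⟩⟩)

end SkewedBinaryPartition

/-! ### The skewed binary partition of a linear functional. -/

section

variable {n : ℕ} {u : Fin n → ℝ}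

/-- The sum of the two interval ends serves as level function: for ordered intervals, equal sums
force equal intervals. A level is homogeneous when its interval is nondegenerate. Different values
of `w` may share a one-point interval; their coordinates then form one non-homogeneous block. -/
lemma exists_rel_eq_relOf (hu0 : ∀ i, 0 ≤ u i) (hu : Monotone u) (w : Fin n → ℝ) :
    ∃ B : SkewedBinaryPartition n, B.rel = relOf u w := by
  set a : Fin (n + 1) → ℝ := fun p => minVal u w (ext0 w p) with ha
  set b : Fin (n + 1) → ℝ := fun p => maxVal u w (ext0 w p) with hb
  have hab : ∀ p, a p ≤ b p := minVal_le_maxVal hu0 hu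
  have hba : ∀ p q, ext0 w p < ext0 w q → b p ≤ a q := fun p q => maxVal_le_minVal hu0 hu
  have heq : ∀ p q, ext0 w p = ext0 w q → a p = a q ∧ b p = b q := fun p q h => by
    simp only [ha, hb, h, and_self]
  have hlevel : ∀ p q, a p + b p = a q + b q → a p = a q ∧ b p = b q := by
    intro p q h
    have h1 := hab p
    have h2 := hab q
    rcases lt_trichotomy (ext0 w p) (ext0 w q) with h' | h' | h'
    · have := hba _ _ h'
      constructor <;> linarith
    · exact heq p q h'
    · have := hba _ _ h'
      constructor <;> linarith
  have hneg : ∀ p, a p + b p < a 0 + b 0 → a p = 0 ∧ b p = 0 := by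
    intro p h
    have : ext0 w p < 0 := by
      by_contra hcon
      rcases (not_lt.1 hcon).lt_or_eq with h' | h'
      · have h1 := hba 0 p (by simpa using h')
        have := hab 0
        have := hab p
        linarith
      · have := heq p 0 (by simpa using h'.symm)
        linarith
    exact ⟨minVal_of_nonpos this.le, maxVal_of_neg this⟩
  have ha0 : a 0 = 0 := minVal_of_nonpos (by simp)
  obtain ⟨B, hB⟩ := SkewedBinaryPartition.exists_of_levels (fun p => a p + b p)
    (fun p => a p < b p) (fun p q h hp => by
      obtain ⟨h1, h2⟩ := hlevel p q h
      rwa [← h1, ← h2])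
    (fun p q hp hq => by
      obtain ⟨h1, h2⟩ := hneg p hp
      obtain ⟨h3, h4⟩ := hneg q hq
      simp only [h1, h2, h3, h4])
    (fun p hp => by
      obtain ⟨h1, h2⟩ := hneg p hp
      rw [h1, h2]; exact lt_irrefl _)
    (fun h0 p => by
      have h1 : 0 ≤ a p := minVal_nonneg hu0 _
      have h2 := hab p
      simp only [ha0] at h0 ⊢
      linarith)
  refine ⟨B, ?_⟩
  funext p q
  rw [eq_iff_iff, hB]
  change _ ↔ p = q ∨ (ext0 w p ≤ ext0 w q ∧ a p < b q)
  have h1 := hab p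
  have h2 := hab q
  refine or_congr_right ?_
  constructor
  · rintro (h | ⟨h, h'⟩)
    · rcases lt_trichotomy (ext0 w p) (ext0 w q) with h' | h' | h'
      · have := hba _ _ h'
        exact ⟨h'.le, by linarith⟩
      · have := heq _ _ h'
        linarith
      · have := hba _ _ h'
        linarith
    · rcases lt_trichotomy (ext0 w p) (ext0 w q) with h3 | h3 | h3
      · exact ⟨h3.le, (hlevel p q h).2 ▸ h'⟩
      · exact ⟨h3.le, (hlevel p q h).2 ▸ h'⟩
      · have := hba _ _ h3
        linarith
  · rintro ⟨h, h'⟩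
    rcases h.lt_or_eq with h3 | h3
    · have := hba _ _ h3
      left
      by_contra hcon
      linarith
    · have := heq _ _ h3
      right
      constructor <;> linarith

end

/-! ### Multiplicity vectors and the set `Ω_m` -/

section Multiplicity

variable {n : ℕ} {u : Fin n → ℝ}

/-- The number of entries of `u` equal to `x`. -/
noncomputable def countEq (u : Fin n → ℝ) (x : ℝ) : ℕ := (Finset.univ.filter fun i => u i = x).card

/-- The multiplicities `(m_1, …, m_ℓ)` of the positive entries of `u`. -/
noncomputable def posMults (u : Fin n → ℝ) : List ℕ := (dataVector u).map (countEq u)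

/-- The number of entries of `u` that are zero or among the `j` smallest positive values. -/
noncomputable def bound (u : Fin n → ℝ) (j : ℕ) : ℕ := countEq u 0 + ((posMults u).take j).sum

lemma multiplicityVector_eq (u : Fin n → ℝ) :
    multiplicityVector u = countEq u 0 :: posMults u := rfl

lemma mem_dataVector {x : ℝ} : x ∈ dataVector u ↔ 0 < x ∧ ∃ i, u i = x := by
  simp only [dataVector, Finset.mem_sort, Finset.mem_filter, Finset.mem_image, Finset.mem_univ,
    true_and]
  exact and_comm

lemma dataVector_sortedLT (u : Fin n → ℝ) : (dataVector u).SortedLT := Finset.sortedLT_sort _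

lemma dataVector_lt_iff {j k : ℕ} (hj : j < (dataVector u).length)
    (hk : k < (dataVector u).length) : (dataVector u)[j] < (dataVector u)[k] ↔ j < k := by
  have := (dataVector_sortedLT u).strictMono_get.lt_iff_lt (a := ⟨j, hj⟩) (b := ⟨k, hk⟩)
  simpa using this

lemma posMults_length (u : Fin n → ℝ) : (posMults u).length = (dataVector u).length :=
  List.length_map _

lemma bound_zero : bound u 0 = countEq u 0 := by simp [bound]

lemma bound_succ {j : ℕ} (hj : j < (dataVector u).length) :
    bound u (j + 1) = bound u j + countEq u (dataVector u)[j] := by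
  have hj' : j < (posMults u).length := by rwa [posMults_length]
  unfold bound
  rw [List.take_add_one, List.getElem?_eq_getElem hj']
  simp [posMults, add_assoc]

lemma bound_mono : Monotone (bound u) := by
  refine monotone_nat_of_le_succ fun j => ?_
  by_cases hj : j < (dataVector u).length
  · rw [bound_succ hj]; exact Nat.le_add_right _ _
  · have h1 : (posMults u).length ≤ j := by rw [posMults_length]; omega
    unfold bound
    rw [List.take_of_length_le h1, List.take_of_length_le (by omega)]

lemma countEq_dataVector_pos {j : ℕ} (hj : j < (dataVector u).length) :
    0 < countEq u (dataVector u)[j] := by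
  obtain ⟨-, i, hi⟩ := mem_dataVector.1 (List.getElem_mem hj)
  exact Finset.card_pos.2 ⟨i, by simp [hi]⟩

lemma numLT_add_countEq (u : Fin n → ℝ) (x : ℝ) : numLT u x + countEq u x = numLE u x := by
  unfold numLT countEq numLE
  rw [← Finset.card_union_of_disjoint]
  · congr 1
    ext i
    simp [le_iff_lt_or_eq]
  · refine Finset.disjoint_left.2 fun i h1 h2 => ?_
    simp only [Finset.mem_filter, Finset.mem_univ, true_and] at h1 h2
    exact h1.ne h2

lemma numLT_dataVector (hu0 : ∀ i, 0 ≤ u i) {j : ℕ} (hj : j < (dataVector u).length) :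
    numLT u (dataVector u)[j] = bound u j := by
  induction j with
  | zero =>
    rw [bound_zero]
    unfold numLT countEq
    congr 1
    ext i
    simp only [Finset.mem_filter, Finset.mem_univ, true_and]
    constructor
    · intro h
      by_contra hne
      have hmem := mem_dataVector.2 ⟨(hu0 i).lt_of_ne' hne, i, rfl⟩
      obtain ⟨k, hk, hk'⟩ := List.getElem_of_mem hmem
      rw [← hk', dataVector_lt_iff] at h
      omega
    · intro h
      rw [h]
      exact (mem_dataVector.1 (List.getElem_mem hj)).1
  | succ j ih =>
    have hj' : j < (dataVector u).length := by omega
    rw [bound_succ hj', ← ih hj', numLT_add_countEq]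
    unfold numLT numLE
    congr 1
    ext i
    simp only [Finset.mem_filter, Finset.mem_univ, true_and]
    constructor
    · intro h
      by_cases h0 : 0 < u i
      · obtain ⟨k, hk, hk'⟩ := List.getElem_of_mem (mem_dataVector.2 ⟨h0, i, rfl⟩)
        rw [← hk', dataVector_lt_iff] at h
        rw [← hk']
        by_contra hcon
        rw [not_le, dataVector_lt_iff] at hcon
        omega
      · exact (not_lt.1 h0).trans (mem_dataVector.1 (List.getElem_mem hj')).1.le
    · intro h
      exact h.trans_lt ((dataVector_lt_iff hj' hj).2 (Nat.lt_succ_self j))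

lemma lt_bound_iff (hu0 : ∀ i, 0 ≤ u i) (hu : Monotone u) {j : ℕ}
    (hj : j < (dataVector u).length) (i : Fin n) :
    (i : ℕ) < bound u j ↔ u i < (dataVector u)[j] := by
  rw [← numLT_dataVector hu0 hj]
  exact lt_numLT_iff (τ := Equiv.refl _) hu _ i

lemma lt_bound_succ_iff (hu0 : ∀ i, 0 ≤ u i) (hu : Monotone u) {j : ℕ}
    (hj : j < (dataVector u).length) (i : Fin n) :
    (i : ℕ) < bound u (j + 1) ↔ u i ≤ (dataVector u)[j] := by
  rw [bound_succ hj, ← numLT_dataVector hu0 hj, numLT_add_countEq]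
  exact lt_numLE_iff (τ := Equiv.refl _) hu _ i

lemma lt_countEq_zero_iff (hu0 : ∀ i, 0 ≤ u i) (hu : Monotone u) (i : Fin n) :
    (i : ℕ) < countEq u 0 ↔ u i = 0 := by
  unfold countEq
  rw [← mem_iff_lt_card]
  · simp
  · intro i j hij hj
    simp only [Finset.mem_filter, Finset.mem_univ, true_and] at hj ⊢
    exact le_antisymm (hj ▸ hu hij) (hu0 i)

lemma countEq_zero_add_sum (hu0 : ∀ i, 0 ≤ u i) : countEq u 0 + (posMults u).sum = n := by
  classical
  have h1 : (posMults u).sum = ∑ x ∈ (dataVector u).toFinset, countEq u x := by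
    rw [List.sum_toFinset _ (dataVector_sortedLT u).nodup]
    rfl
  have h2 : (0 : ℝ) ∉ (dataVector u).toFinset := by
    rw [List.mem_toFinset, mem_dataVector]
    exact fun h => lt_irrefl _ h.1
  rw [h1, ← Finset.sum_insert h2]
  have h3 := Finset.card_eq_sum_card_fiberwise (f := u) (s := Finset.univ)
    (t := insert 0 (dataVector u).toFinset) (by
      intro i _
      rcases (hu0 i).eq_or_lt with h | h
      · exact Finset.mem_coe.2 (Finset.mem_insert.2 (.inl h.symm))
      · exact Finset.mem_coe.2 (Finset.mem_insert.2
          (.inr (List.mem_toFinset.2 (mem_dataVector.2 ⟨h, i, rfl⟩)))))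
  rw [Finset.card_univ, Fintype.card_fin] at h3
  exact h3.symm

lemma bound_length (hu0 : ∀ i, 0 ≤ u i) : bound u (dataVector u).length = n := by
  unfold bound
  rw [List.take_of_length_le (posMults_length u).le]
  exact countEq_zero_add_sum hu0

lemma dataVector_length_pos (hu0 : ∀ i, 0 ≤ u i) (hne : u ≠ 0) : 0 < (dataVector u).length := by
  obtain ⟨i, hi⟩ := Function.ne_iff.1 hne
  exact List.length_pos_of_mem (mem_dataVector.2 ⟨(hu0 i).lt_of_ne' hi, i, rfl⟩)

lemma countEq_zero_lt (hu0 : ∀ i, 0 ≤ u i) (hne : u ≠ 0) : countEq u 0 < n := by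
  have h := dataVector_length_pos hu0 hne
  have h1 := bound_succ h
  have h2 := countEq_dataVector_pos h
  have h3 := bound_mono (u := u) (show 0 + 1 ≤ (dataVector u).length by omega)
  rw [bound_length hu0] at h3
  rw [bound_zero] at h1
  omega

/-- The distinct values of `u` at positions `≥ K`, in increasing order. -/
noncomputable def tailValues (u : Fin n → ℝ) (K : ℕ) : List ℝ :=
  ((Finset.univ.filter fun i : Fin n => K ≤ i).image u).sort (· ≤ ·)

/-- The number of positions `≥ K` at which `u` has the value `x`. -/
noncomputable def tailCount (u : Fin n → ℝ) (K : ℕ) (x : ℝ) : ℕ :=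
  (Finset.univ.filter fun i : Fin n => K ≤ i ∧ u i = x).card

lemma mem_tailValues {K : ℕ} {x : ℝ} : x ∈ tailValues u K ↔ ∃ i : Fin n, K ≤ i ∧ u i = x := by
  simp [tailValues]

lemma tailValues_sortedLT (u : Fin n → ℝ) (K : ℕ) : (tailValues u K).SortedLT :=
  Finset.sortedLT_sort _

/-- Locates the run of equal entries of `u` that contains position `K`; `j + 1` is the index g in
the definition of Ω_m. -/
lemma exists_bound_le_lt (hu0 : ∀ i, 0 ≤ u i) {K : ℕ} (h0 : countEq u 0 ≤ K) (hK : K < n) :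
    ∃ j < (dataVector u).length, bound u j ≤ K ∧ K < bound u (j + 1) := by
  classical
  have hex : ∃ j, K < bound u j := ⟨_, by rwa [bound_length hu0]⟩
  have hpos : Nat.find hex ≠ 0 := by
    intro h
    have := Nat.find_spec hex
    rw [h, bound_zero] at this
    omega
  have hle : Nat.find hex ≤ (dataVector u).length := Nat.find_min' hex (by rwa [bound_length hu0])
  refine ⟨Nat.find hex - 1, by omega, ?_, ?_⟩
  · exact not_lt.1 (Nat.find_min hex (by omega))
  · have := Nat.find_spec hex
    rwa [Nat.sub_add_cancel (by omega)]

lemma tailValues_eq_drop (hu0 : ∀ i, 0 ≤ u i) (hu : Monotone u) {j K : ℕ}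
    (hj : j < (dataVector u).length) (h1 : bound u j ≤ K) (h2 : K < bound u (j + 1)) :
    tailValues u K = (dataVector u).drop j := by
  classical
  have hsort : ((dataVector u).drop j).SortedLT := by
    have := (dataVector_sortedLT u).pairwise.drop (i := j)
    exact this.sortedLT
  have hKn : K < n := by
    have := bound_mono (u := u) (show j + 1 ≤ (dataVector u).length by omega)
    rw [bound_length hu0] at this
    omega
  have hset : (Finset.univ.filter fun i : Fin n => K ≤ i).image u =
      ((dataVector u).drop j).toFinset := by
    ext x
    rw [List.mem_toFinset, List.mem_drop_iff_getElem]
    simp only [Finset.mem_image, Finset.mem_filter, Finset.mem_univ, true_and]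
    constructor
    · rintro ⟨i, hi, rfl⟩
      have h0 : u i ≠ 0 := by
        rw [Ne, ← lt_countEq_zero_iff hu0 hu, ← bound_zero]
        have := bound_mono (u := u) (Nat.zero_le j)
        omega
      obtain ⟨k, hk, hk'⟩ := List.getElem_of_mem (mem_dataVector.2
        ⟨(hu0 i).lt_of_ne' h0, i, rfl⟩)
      have hjk : j ≤ k := by
        by_contra hcon
        have h3 := (lt_bound_succ_iff hu0 hu hk i).2 hk'.ge
        have h4 := bound_mono (u := u) (show k + 1 ≤ j by omega)
        omega
      refine ⟨k - j, by omega, ?_⟩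
      rw [← hk']
      congr 1
      omega
    · rintro ⟨k, hk, rfl⟩
      have hk : j + k < (dataVector u).length := by omega
      rcases Nat.eq_zero_or_pos k with rfl | hk0
      · refine ⟨⟨K, hKn⟩, le_rfl, ?_⟩
        have h3 := (lt_bound_succ_iff hu0 hu hj ⟨K, hKn⟩).1 h2
        have h4 := (lt_bound_iff hu0 hu hj ⟨K, hKn⟩).not.1 (by simpa using h1)
        simpa using le_antisymm h3 (not_lt.1 h4)
      · obtain ⟨-, i, hi⟩ := mem_dataVector.1 (List.getElem_mem hk)
        refine ⟨i, ?_, hi⟩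
        have h3 := (lt_bound_iff hu0 hu hk i).not.2 (by rw [hi]; exact lt_irrefl _)
        have h4 := bound_mono (u := u) (show j + 1 ≤ j + k by omega)
        omega
  unfold tailValues
  rw [hset, List.toFinset_sort _ hsort.nodup]
  exact hsort.pairwise.imp le_of_lt

/-- The multiplicities of the values of `u` at positions `≥ K`. -/
noncomputable def tailMults (u : Fin n → ℝ) (K : ℕ) : List ℕ :=
  (tailValues u K).map (tailCount u K)

/-- Cutting at `K` shortens the run containing `K` and leaves the later runs intact. -/
lemma tailMults_eq (hu0 : ∀ i, 0 ≤ u i) (hu : Monotone u) {j K : ℕ}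
    (hj : j < (dataVector u).length) (h1 : bound u j ≤ K) (h2 : K < bound u (j + 1)) :
    tailMults u K = (bound u (j + 1) - K) :: (posMults u).drop (j + 1) := by
  classical
  unfold tailMults
  rw [tailValues_eq_drop hu0 hu hj h1 h2, List.drop_eq_getElem_cons hj, List.map_cons, posMults,
    ← List.map_drop]
  have hle : bound u (j + 1) ≤ n :=
    (bound_mono (by omega)).trans_eq (bound_length hu0)
  congr 1
  · have : (Finset.univ.filter fun i : Fin n => K ≤ i ∧ u i = (dataVector u)[j]).map
        Fin.valEmbedding = Finset.Ico K (bound u (j + 1)) := by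
      ext x
      simp only [Finset.mem_map, Finset.mem_filter, Finset.mem_univ, true_and, Finset.mem_Ico,
        Fin.valEmbedding_apply]
      constructor
      · rintro ⟨i, ⟨hi, hi'⟩, rfl⟩
        exact ⟨hi, (lt_bound_succ_iff hu0 hu hj i).2 hi'.le⟩
      · rintro ⟨hx, hx'⟩
        refine ⟨⟨x, by omega⟩, ⟨hx, ?_⟩, rfl⟩
        refine le_antisymm ((lt_bound_succ_iff hu0 hu hj _).1 hx') (not_lt.1 ?_)
        rw [← lt_bound_iff hu0 hu hj]
        simp only
        omega
    rw [tailCount, ← Finset.card_map Fin.valEmbedding, this, Nat.card_Ico]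
  · refine List.map_congr_left fun x hx => ?_
    rw [List.mem_drop_iff_getElem] at hx
    obtain ⟨k, hk, rfl⟩ := hx
    have hk : j + 1 + k < (dataVector u).length := by omega
    unfold tailCount countEq
    congr 1
    ext i
    simp only [Finset.mem_filter, Finset.mem_univ, true_and, and_iff_right_iff_imp]
    intro hi
    have h3 := (lt_bound_iff hu0 hu hk i).not.2 (by rw [hi]; exact lt_irrefl _)
    have h4 := bound_mono (u := u) (show j + 1 ≤ j + 1 + k by omega)
    omega

lemma tailMults_of_le {K : ℕ} (hK : n ≤ K) : tailMults u K = [] := by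
  have : tailValues u K = [] := by
    rw [List.eq_nil_iff_forall_not_mem]
    intro x hx
    obtain ⟨i, hi, -⟩ := mem_tailValues.1 hx
    have := i.2
    omega
  simp [tailMults, this]

lemma tailMults_countEq_zero (hu0 : ∀ i, 0 ≤ u i) (hu : Monotone u) (hne : u ≠ 0) :
    tailMults u (countEq u 0) = posMults u := by
  have h := dataVector_length_pos hu0 hne
  have h1 := bound_succ h
  have h2 := countEq_dataVector_pos h
  rw [bound_zero] at h1
  rw [tailMults_eq hu0 hu h bound_zero.le (by omega), h1, Nat.add_sub_cancel_left]
  have h' : 0 < (posMults u).length := by rwa [posMults_length]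
  conv_rhs => rw [← List.drop_zero (l := posMults u), List.drop_eq_getElem_cons h']
  simp [posMults]

open Classical in
/-- The first two entries of the elements of `Ω_m`. -/
noncomputable def omegaHead (m₀ K : ℕ) : List Entry :=
  if K = m₀ ∧ 0 < m₀ then [Entry.plain K, Entry.plain 0] else [Entry.plain K, Entry.circ 0]

/-- With K = m₀ + i the three cases of Ω_m become one: the tail lists the multiplicities of `u` from
position `K` on. Only the head treats K = m₀ > 0 separately. -/
lemma mem_Omega_iff (hu0 : ∀ i, 0 ≤ u i) (hu : Monotone u) (hne : u ≠ 0) (b : List Entry) :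
    b ∈ Omega (multiplicityVector u) ↔ ∃ K, countEq u 0 ≤ K ∧ K ≤ n ∧
      b = omegaHead (countEq u 0) K ++ (tailMults u K).map Entry.plain := by
  have hlt := countEq_zero_lt hu0 hne
  have hsum := countEq_zero_add_sum hu0
  have hzero : omegaZero (countEq u 0) (posMults u) = omegaHead (countEq u 0) (countEq u 0) ++
      (tailMults u (countEq u 0)).map Entry.plain := by
    rw [tailMults_countEq_zero hu0 hu hne]
    unfold omegaZero omegaHead
    by_cases h : 0 < countEq u 0
    · rw [if_pos h, if_pos ⟨rfl, h⟩]
    · rw [if_neg h, if_neg fun h' => h h'.2]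
      have : countEq u 0 = 0 := by omega
      rw [this]
  have hlast : [Entry.plain (countEq u 0 + (posMults u).sum), Entry.circ 0] =
      omegaHead (countEq u 0) n ++ (tailMults u n).map Entry.plain := by
    rw [tailMults_of_le le_rfl, hsum]
    unfold omegaHead
    rw [if_neg (by omega)]
    rfl
  have hmid : ∀ i j : ℕ, 1 ≤ i → j < (dataVector u).length → bound u j ≤ countEq u 0 + i →
      countEq u 0 + i < bound u (j + 1) →
      [Entry.plain (countEq u 0 + i), Entry.circ 0,
        Entry.plain (((posMults u).take (j + 1)).sum - i)] ++
          ((posMults u).drop (j + 1)).map Entry.plain =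
      omegaHead (countEq u 0) (countEq u 0 + i) ++
        (tailMults u (countEq u 0 + i)).map Entry.plain := by
    intro i j hi hj h1 h2
    rw [tailMults_eq hu0 hu hj h1 h2]
    unfold omegaHead bound
    rw [if_neg (by omega), Nat.add_sub_add_left]
    rfl
  rw [multiplicityVector_eq]
  simp only [Omega, Set.mem_union, Set.mem_singleton_iff, Set.mem_ofPred_eq]
  constructor
  · rintro ((rfl | ⟨i, g, hi, hg, h1, h2, rfl⟩) | rfl)
    · exact ⟨_, le_rfl, hlt.le, hzero⟩
    · obtain ⟨j, rfl⟩ : ∃ j, g = j + 1 := ⟨g - 1, by omega⟩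
      rw [Nat.add_sub_cancel] at h1
      have hj : j < (dataVector u).length := by
        by_contra hcon
        have hl : (posMults u).length ≤ j := by rw [posMults_length]; omega
        rw [List.take_of_length_le hl] at h1
        rw [List.take_of_length_le (by omega)] at h2
        omega
      have hle : bound u (j + 1) ≤ n :=
        (bound_mono (by omega)).trans_eq (bound_length hu0)
      have hb : countEq u 0 + i < bound u (j + 1) := by unfold bound; omega
      exact ⟨countEq u 0 + i, by omega, by omega,
        hmid i j hi hj (by unfold bound; omega) hb⟩
    · exact ⟨n, hlt.le, le_rfl, hlast⟩
  · rintro ⟨K, hK, hKn, rfl⟩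
    rcases hK.eq_or_lt with rfl | hK'
    · exact .inl (.inl hzero.symm)
    · rcases hKn.eq_or_lt with rfl | hKn'
      · exact .inr hlast.symm
      · obtain ⟨j, hj, h1, h2⟩ := exists_bound_le_lt hu0 hK hKn'
        obtain ⟨i, rfl⟩ : ∃ i, K = countEq u 0 + i := ⟨K - countEq u 0, by omega⟩
        refine .inl (.inr ⟨i, j + 1, by omega, by omega, ?_, ?_,
          (hmid i j (by omega) hj h1 h2).symm⟩)
        · rw [Nat.add_sub_cancel]
          unfold bound at h1
          omega
        · unfold bound at h2
          omega

end Multiplicity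

/-! ### Chambers: the skewed binary partitions with type in `Ω_m` -/

section Chamber

variable {n : ℕ} {u : Fin n → ℝ} {K : ℕ}

open Classical in
/-- The index of the block containing the `i`-th coordinate in the order of a chamber. -/
noncomputable def posIndex (u : Fin n → ℝ) (K : ℕ) (i : Fin n) : ℕ :=
  -- Index 1 is skipped: in a chamber B_0 contains at most the element 0.
  if (i : ℕ) < K then 0 else (tailValues u K).idxOf (u i) + 2

lemma posIndex_of_lt {i : Fin n} (h : (i : ℕ) < K) : posIndex u K i = 0 := if_pos h

lemma posIndex_of_le {i : Fin n} (h : K ≤ (i : ℕ)) :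
    posIndex u K i = (tailValues u K).idxOf (u i) + 2 := if_neg h.not_gt

lemma posIndex_ne_one (i : Fin n) : posIndex u K i ≠ 1 := by
  unfold posIndex
  split_ifs <;> omega

lemma posIndex_eq_zero_iff {i : Fin n} : posIndex u K i = 0 ↔ (i : ℕ) < K := by
  unfold posIndex
  split_ifs with h <;> simp [h]

lemma idxOf_tailValues_lt {i : Fin n} (h : K ≤ (i : ℕ)) :
    (tailValues u K).idxOf (u i) < (tailValues u K).length :=
  List.idxOf_lt_length_iff.2 (mem_tailValues.2 ⟨i, h, rfl⟩)

lemma posIndex_lt (i : Fin n) : posIndex u K i < (tailValues u K).length + 2 := by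
  by_cases h : (i : ℕ) < K
  · rw [posIndex_of_lt h]; omega
  · rw [posIndex_of_le (not_lt.1 h)]
    have := idxOf_tailValues_lt (u := u) (not_lt.1 h)
    omega

lemma posIndex_eq_add_two_iff {i : Fin n} {t : ℕ} (ht : t < (tailValues u K).length) :
    posIndex u K i = t + 2 ↔ K ≤ (i : ℕ) ∧ u i = (tailValues u K)[t] := by
  constructor
  · intro h
    have hi : K ≤ (i : ℕ) := by
      by_contra hcon
      rw [posIndex_of_lt (not_le.1 hcon)] at h
      omega
    rw [posIndex_of_le hi] at h
    refine ⟨hi, ?_⟩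
    have := List.getElem_idxOf (idxOf_tailValues_lt (u := u) hi)
    rw [← this]
    congr 1
    omega
  · rintro ⟨hi, h⟩
    rw [posIndex_of_le hi, h, (tailValues_sortedLT u K).nodup.idxOf_getElem]

lemma posIndex_lt_of_lt (hu : Monotone u) {i j : Fin n} (hi : K ≤ (i : ℕ)) (h : u i < u j) :
    posIndex u K i < posIndex u K j := by
  have hij : i < j := not_le.1 fun h' => h.not_ge (hu h')
  have hj : K ≤ (j : ℕ) := hi.trans hij.le
  rw [posIndex_of_le hi, posIndex_of_le hj]
  have h1 := idxOf_tailValues_lt (u := u) hi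
  have h2 := idxOf_tailValues_lt (u := u) hj
  have h3 := (tailValues_sortedLT u K).strictMono_get.lt_iff_lt (a := ⟨_, h1⟩) (b := ⟨_, h2⟩)
  simp only [List.get_eq_getElem, List.getElem_idxOf, Fin.mk_lt_mk] at h3
  have := h3.1 h
  omega

lemma posIndex_mono (hu : Monotone u) : Monotone (posIndex u K) := by
  intro i j hij
  by_cases hi : (i : ℕ) < K
  · rw [posIndex_of_lt hi]; exact Nat.zero_le _
  · rcases (hu hij).lt_or_eq with h | h
    · exact (posIndex_lt_of_lt hu (not_lt.1 hi) h).le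
    · have hj : K ≤ (j : ℕ) := (not_lt.1 hi).trans hij
      rw [posIndex_of_le (not_lt.1 hi), posIndex_of_le hj, h]

lemma eq_of_posIndex_eq (hu : Monotone u) {i j : Fin n} (hi : K ≤ (i : ℕ)) (hj : K ≤ (j : ℕ))
    (h : posIndex u K i = posIndex u K j) : u i = u j := by
  rcases lt_trichotomy (u i) (u j) with h' | h' | h'
  · exact absurd h (posIndex_lt_of_lt hu hi h').ne
  · exact h'
  · exact absurd h (posIndex_lt_of_lt hu hj h').ne'

lemma lt_of_posIndex_lt (hu : Monotone u) {i j : Fin n} (hi : K ≤ (i : ℕ))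
    (h : posIndex u K i < posIndex u K j) : u i < u j := by
  have hij : i < j := not_le.1 fun h' => h.not_ge (posIndex_mono hu h')
  have hj : K ≤ (j : ℕ) := hi.trans hij.le
  refine (hu hij.le).lt_of_ne fun heq => ?_
  rw [posIndex_of_le hi, posIndex_of_le hj, heq] at h
  exact lt_irrefl _ h

open Classical in
/-- The index of the block of a chamber containing `0`. -/
noncomputable def zeroIndex (m₀ K : ℕ) : ℕ := if K = m₀ ∧ 0 < m₀ then 0 else 1

lemma zeroIndex_le (m₀ K : ℕ) : zeroIndex m₀ K ≤ 1 := by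
  unfold zeroIndex
  split_ifs <;> omega

/-- `A` is the partition without homogeneous blocks whose first block consists of the first `K`
coordinates in the order `τ`, possibly together with `0`, and whose later blocks are given by the
values of `u`. -/
structure IsChamber (u : Fin n → ℝ) (K : ℕ) (τ : Equiv.Perm (Fin n))
    (A : SkewedBinaryPartition n) : Prop where
  k_eq : A.k = (tailValues u K).length
  homog : ∀ t, A.homog t = false
  idx_zero : (A.idx 0 : ℕ) = zeroIndex (countEq u 0) K
  idx_succ : ∀ i, (A.idx (τ i).succ : ℕ) = posIndex u K i

lemma card_succ_mem (s : Finset (Fin (n + 1))) :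
    (Finset.univ.filter fun i : Fin n => i.succ ∈ s).card = (s.erase 0).card := by
  rw [← Finset.card_map (Fin.succEmb n)]
  congr 1
  ext p
  simp only [Finset.mem_map, Finset.mem_filter, Finset.mem_univ, true_and, Fin.coe_succEmb,
    Finset.mem_erase]
  constructor
  · rintro ⟨i, hi, rfl⟩
    exact ⟨Fin.succ_ne_zero i, hi⟩
  · rintro ⟨h, h'⟩
    obtain ⟨i, rfl⟩ := Fin.exists_succ_eq.2 h
    exact ⟨i, h', rfl⟩

lemma card_posIndex_eq_zero (hK : K ≤ n) :
    (Finset.univ.filter fun i : Fin n => posIndex u K i = 0).card = K := by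
  have : (Finset.univ.filter fun i : Fin n => posIndex u K i = 0).map Fin.valEmbedding =
      Finset.range K := by
    ext x
    simp only [Finset.mem_map, Finset.mem_filter, Finset.mem_univ, true_and, Finset.mem_range,
      Fin.valEmbedding_apply, posIndex_eq_zero_iff]
    constructor
    · rintro ⟨i, hi, rfl⟩
      exact hi
    · intro hx
      exact ⟨⟨x, by omega⟩, hx, rfl⟩
  rw [← Finset.card_map Fin.valEmbedding, this, Finset.card_range]

lemma card_posIndex_eq_add_two {t : ℕ} (ht : t < (tailValues u K).length) :
    (Finset.univ.filter fun i : Fin n => posIndex u K i = t + 2).card =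
      tailCount u K (tailValues u K)[t] := by
  unfold tailCount
  simp only [posIndex_eq_add_two_iff ht]

lemma IsChamber.card_block {τ : Equiv.Perm (Fin n)} {A : SkewedBinaryPartition n}
    (h : IsChamber u K τ A) (t : Fin (A.k + 2)) :
    ((A.block t).erase 0).card =
      (Finset.univ.filter fun i : Fin n => posIndex u K i = (t : ℕ)).card := by
  rw [← card_succ_mem]
  refine (Finset.card_equiv τ fun i => ?_).symm
  simp only [Finset.mem_filter, Finset.mem_univ, true_and, A.mem_block_iff, Fin.ext_iff,
    h.idx_succ]

lemma IsChamber.type_eq {τ : Equiv.Perm (Fin n)} {A : SkewedBinaryPartition n}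
    (h : IsChamber u K τ A) (hK : K ≤ n) :
    A.type = omegaHead (countEq u 0) K ++ (tailMults u K).map Entry.plain := by
  have hone : ((1 : Fin (A.k + 2)) : ℕ) = 1 := rfl
  have hzero : ((0 : Fin (A.k + 2)) : ℕ) = 0 := rfl
  have hb0 := h.card_block 0
  rw [hzero, card_posIndex_eq_zero hK] at hb0
  have hb1 := h.card_block 1
  rw [hone] at hb1
  simp only [posIndex_ne_one, Finset.filter_false, Finset.card_empty] at hb1
  have hz : 0 ∈ A.block 1 ↔ zeroIndex (countEq u 0) K = 1 := by
    rw [A.mem_block_iff, Fin.ext_iff, h.idx_zero, hone]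
  have hz' : 0 ∈ A.block 0 ↔ zeroIndex (countEq u 0) K = 0 := by
    rw [A.mem_block_iff, Fin.ext_iff, h.idx_zero, hzero]
  unfold SkewedBinaryPartition.type
  congr 1
  · by_cases hc : K = countEq u 0 ∧ 0 < countEq u 0
    · have hzi : zeroIndex (countEq u 0) K = 0 := if_pos hc
      have h0 : 0 ∈ A.block 0 := hz'.2 hzi
      rw [Finset.card_erase_of_mem h0] at hb0
      rw [if_neg (by rw [hz, hzi]; omega), hb0, omegaHead, if_pos hc]
    · have hzi : zeroIndex (countEq u 0) K = 1 := if_neg hc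
      have h0 : 0 ∉ A.block 0 := by rw [hz', hzi]; omega
      have h1 : 0 ∈ A.block 1 := hz.2 hzi
      rw [Finset.erase_eq_of_notMem h0] at hb0
      rw [Finset.card_erase_of_mem h1] at hb1
      rw [if_pos h1, hb0, hb1, omegaHead, if_neg hc]
  · refine List.ext_getElem (by simp [tailMults, h.k_eq]) fun i h1 h2 => ?_
    have hi : i < (tailValues u K).length := by simpa [tailMults] using h2
    simp only [List.getElem_ofFn, h.homog, Bool.false_eq_true, if_false, List.getElem_map,
      tailMults, Entry.plain.injEq]
    have hb := h.card_block (Fin.succ (Fin.succ ⟨i, by rw [h.k_eq]; exact hi⟩))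
    rw [Finset.erase_eq_of_notMem] at hb
    · rw [hb, ← card_posIndex_eq_add_two hi]
      simp
    · rw [A.mem_block_iff, Fin.ext_iff, h.idx_zero]
      have := zeroIndex_le (countEq u 0) K
      simp only [Fin.val_succ]
      omega

/-- The type fixes the block sizes, so each block has as many coordinates as there are positions
with its index; bijections between these fibers assemble to `τ`. Plain entries exclude homogeneous
blocks. -/
lemma exists_isChamber_of_type (hK : K ≤ n) {A : SkewedBinaryPartition n}
    (h : A.type = omegaHead (countEq u 0) K ++ (tailMults u K).map Entry.plain) :
    ∃ τ, IsChamber u K τ A := by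
  have hone : ((1 : Fin (A.k + 2)) : ℕ) = 1 := rfl
  have hzero : ((0 : Fin (A.k + 2)) : ℕ) = 0 := rfl
  have hne10 : (1 : Fin (A.k + 2)) ≠ 0 := by rw [Ne, Fin.ext_iff, hone, hzero]; omega
  unfold SkewedBinaryPartition.type at h
  obtain ⟨hhead, htail⟩ := List.append_inj h (by unfold omegaHead; split_ifs <;> rfl)
  have hk : A.k = (tailValues u K).length := by
    have := congrArg List.length htail
    simpa [tailMults] using this
  have hentry : ∀ t : Fin A.k, A.homog t.succ.succ = false ∧
      (A.block t.succ.succ).card = tailCount u K ((tailValues u K)[(t : ℕ)]'(hk ▸ t.2)) := by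
    intro t
    have ht : (t : ℕ) < (tailValues u K).length := hk ▸ t.2
    have h1 := List.getElem_of_eq htail (i := t) (by simp)
    simp only [List.getElem_ofFn, List.getElem_map, tailMults, Fin.eta] at h1
    by_cases hh : A.homog t.succ.succ = true
    · rw [if_pos hh] at h1
      exact absurd h1 (by simp)
    · rw [if_neg hh] at h1
      exact ⟨by simpa using hh, by simpa using h1⟩
  have hfirst : (A.idx 0 : ℕ) = zeroIndex (countEq u 0) K ∧ ((A.block 0).erase 0).card = K ∧
      (A.block 1).erase 0 = ∅ := by
    by_cases hc : K = countEq u 0 ∧ 0 < countEq u 0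
    · rw [omegaHead, if_pos hc] at hhead
      have h1 : 0 ∉ A.block 1 := by
        intro h1
        rw [if_pos h1] at hhead
        simp at hhead
      rw [if_neg h1] at hhead
      have h0 : 0 ∈ A.block 0 := A.zero_mem.resolve_right h1
      refine ⟨?_, ?_, ?_⟩
      · rw [A.mem_block_iff.1 h0, zeroIndex, if_pos hc]; rfl
      · rw [Finset.card_erase_of_mem h0]
        simpa using hhead
      · rw [(A.of_zero_mem_first h0).2]; rfl
    · rw [omegaHead, if_neg hc] at hhead
      have h1 : 0 ∈ A.block 1 := by
        by_contra h1
        rw [if_neg h1] at hhead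
        simp at hhead
      rw [if_pos h1] at hhead
      simp only [List.cons.injEq, Entry.plain.injEq, Entry.circ.injEq, and_true] at hhead
      have h0 : 0 ∉ A.block 0 := by
        rw [A.mem_block_iff, A.mem_block_iff.1 h1]
        exact hne10
      refine ⟨?_, ?_, ?_⟩
      · rw [A.mem_block_iff.1 h1, zeroIndex, if_neg hc]; rfl
      · rw [Finset.erase_eq_of_notMem h0]
        exact hhead.1
      · rw [← Finset.card_eq_zero, Finset.card_erase_of_mem h1]
        exact hhead.2
  obtain ⟨hidx0, hb0, hb1⟩ := hfirst
  have hz1 := zeroIndex_le (countEq u 0) K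
  have hfiber : ∀ t : ℕ, (Finset.univ.filter fun i : Fin n => posIndex u K i = t).card =
      (Finset.univ.filter fun i : Fin n => (A.idx i.succ : ℕ) = t).card := by
    intro t
    by_cases ht : t < A.k + 2
    · have heq : (Finset.univ.filter fun i : Fin n => (A.idx i.succ : ℕ) = t).card =
          ((A.block ⟨t, ht⟩).erase 0).card := by
        rw [← card_succ_mem]
        simp only [A.mem_block_iff, Fin.ext_iff]
      rw [heq]
      rcases t with _ | _ | t
      · rw [card_posIndex_eq_zero hK]
        exact hb0.symm
      · simp only [zero_add, posIndex_ne_one, Finset.filter_false, Finset.card_empty]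
        exact (Finset.card_eq_zero.2 hb1).symm
      · have ht' : t < A.k := by omega
        rw [card_posIndex_eq_add_two (hk ▸ ht')]
        have h1 := (hentry ⟨t, ht'⟩).2
        rw [Finset.erase_eq_of_notMem]
        · exact h1.symm
        · rw [A.mem_block_iff, Fin.ext_iff]
          simp only
          omega
    · rw [Finset.card_eq_zero.2, Finset.card_eq_zero.2]
      · refine Finset.filter_eq_empty_iff.2 fun i _ h' => ?_
        have := (A.idx i.succ).2
        omega
      · refine Finset.filter_eq_empty_iff.2 fun i _ h' => ?_
        have := posIndex_lt (u := u) (K := K) i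
        omega
  have e : ∀ t : ℕ, {i : Fin n // posIndex u K i = t} ≃ {i : Fin n // (A.idx i.succ : ℕ) = t} := by
    intro t
    refine Fintype.equivOfCardEq ?_
    rw [Fintype.card_subtype, Fintype.card_subtype]
    exact hfiber t
  refine ⟨Equiv.ofFiberEquiv e, hk, fun t => ?_, hidx0, fun i => Equiv.ofFiberEquiv_map e i⟩
  by_contra hcon
  have hcon : A.homog t = true := by simpa using hcon
  have h2 := A.two_le_of_homog t hcon
  induction t using Fin.cases with
  | zero => rw [A.homog_first] at hcon; simp at hcon
  | succ t =>
    induction t using Fin.cases with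
    | zero =>
      have := Finset.card_le_card (Finset.subset_insert_iff.2 hb1.subset)
      change (A.block 1).card ≤ _ at this
      change 2 ≤ (A.block 1).card at h2
      simp at this
      omega
    | succ t =>
      rw [(hentry t).1] at hcon
      simp at hcon

lemma nthEntry_level {w : Fin n → ℝ} {τ : Equiv.Perm (Fin n)} (hτ : Monotone (w ∘ τ)) {p : Fin n}
    {c : ℝ} (h : ∀ i, w (τ i) = w p → u i = c) :
    nthEntry u (numLE w (w p)) = c ∧ nthEntry u (numLT w (w p) + 1) = c := by
  have h1 := numLT_lt_numLE (w := w) p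
  have h2 := numLE_le w (w p)
  have key : ∀ j : Fin n, numLT w (w p) ≤ j → (j : ℕ) < numLE w (w p) →
      nthEntry u (j + 1) = c := by
    intro j hj hj'
    rw [nthEntry_succ]
    refine h j (le_antisymm ((lt_numLE_iff hτ _ j).1 hj') (not_lt.1 ?_))
    rw [← lt_numLT_iff hτ]
    omega
  constructor
  · have := key ⟨numLE w (w p) - 1, by omega⟩ (by simp only; omega) (by simp only; omega)
    simpa only [Nat.sub_add_cancel (show 1 ≤ numLE w (w p) by omega)] using this
  · exact key ⟨numLT w (w p), by omega⟩ le_rfl h1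

/-- The functional is the block index relative to that of 0. Since `u` is constant along each later
block, the intervals there are points, strictly increasing from block to block. The interval at 0
runs from 0 to the `K`-th entry of `u`, and for `K > 0` it is a point exactly if K = m₀, the case in
which 0 joins the first block. -/
lemma IsChamber.exists_rel_eq (hu0 : ∀ i, 0 ≤ u i) (hu : Monotone u) (hK0 : countEq u 0 ≤ K)
    (hK : K ≤ n) {τ : Equiv.Perm (Fin n)} {A : SkewedBinaryPartition n}
    (h : IsChamber u K τ A) : ∃ w, A.rel = relOf u w := by
  set w : Fin n → ℝ := fun i => (A.idx i.succ : ℝ) - (A.idx 0 : ℝ) with hw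
  have hext : ∀ p, ext0 w p = (A.idx p : ℝ) - (A.idx 0 : ℝ) :=
    ext0_sub_const (fun p => (A.idx p : ℝ))
  have hz1 := zeroIndex_le (countEq u 0) K
  have hi0 := h.idx_zero
  have hτw : Monotone (w ∘ τ) := by
    intro i j hij
    simp only [hw, Function.comp_apply, h.idx_succ]
    exact sub_le_sub_right (Nat.cast_le.2 (posIndex_mono hu hij)) _
  have hpos : ∀ i : Fin n, K ≤ (i : ℕ) → 0 < u i := by
    intro i hi
    refine (hu0 i).lt_of_ne' ?_
    rw [Ne, ← lt_countEq_zero_iff hu0 hu]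
    omega
  have hhigh : ∀ i : Fin n, K ≤ (i : ℕ) → minVal u w (ext0 w (τ i).succ) = u i ∧
      maxVal u w (ext0 w (τ i).succ) = u i := by
    intro i hi
    have hw0 : 0 < w (τ i) := by
      simp only [hw, h.idx_succ, hi0, posIndex_of_le hi, sub_pos, Nat.cast_lt]
      omega
    have hl := nthEntry_level (u := u) hτw (p := τ i) (c := u i) (by
      intro j hj
      simp only [hw, h.idx_succ, sub_left_inj, Nat.cast_inj] at hj
      have hKj : K ≤ (j : ℕ) := by
        by_contra hcon
        rw [posIndex_of_lt (not_le.1 hcon), posIndex_of_le hi] at hj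
        omega
      exact eq_of_posIndex_eq hu hKj hi hj)
    rw [ext0_succ, minVal_of_pos hw0, maxVal_of_nonneg hw0.le]
    exact ⟨hl.2, hl.1⟩
  have hnum : numLE w 0 = K := by
    have hiff : ∀ j : Fin n, (j : ℕ) < numLE w 0 ↔ (j : ℕ) < K := by
      intro j
      rw [lt_numLE_iff hτw]
      simp only [hw, h.idx_succ, sub_nonpos, Nat.cast_le, hi0]
      constructor
      · intro hle
        by_contra hcon
        rw [posIndex_of_le (not_lt.1 hcon)] at hle
        omega
      · intro hlt
        rw [posIndex_of_lt hlt]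
        exact Nat.zero_le _
    have hle := numLE_le w 0
    rcases lt_trichotomy (numLE w 0) K with hlt | heq | hlt
    · have := (hiff ⟨numLE w 0, by omega⟩).2 hlt
      simp at this
    · exact heq
    · have := (hiff ⟨K, by omega⟩).1 hlt
      simp at this
  have hcases : ∀ p, (∃ i : Fin n, K ≤ (i : ℕ) ∧ p = (τ i).succ) ∨ (A.idx p : ℕ) ≤ 1 := by
    intro p
    induction p using Fin.cases with
    | zero => right; omega
    | succ p =>
      obtain ⟨i, rfl⟩ := τ.surjective p
      by_cases hi : (i : ℕ) < K
      · right
        rw [h.idx_succ, posIndex_of_lt hi]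
        omega
      · exact .inl ⟨i, not_lt.1 hi, rfl⟩
  have hidx1 : ∀ p, (A.idx p : ℕ) = 1 → p = 0 := by
    intro p
    induction p using Fin.cases with
    | zero => intro _; rfl
    | succ p =>
      obtain ⟨i, rfl⟩ := τ.surjective p
      rw [h.idx_succ]
      intro h1
      exact absurd h1 (posIndex_ne_one i)
  have hlow : ∀ p, (A.idx p : ℕ) ≤ 1 → ext0 w p ≤ 0 := by
    intro p hp
    rw [hext, sub_nonpos, Nat.cast_le]
    rcases Nat.le_one_iff_eq_zero_or_eq_one.1 hp with h0 | h0
    · omega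
    · rw [hidx1 p h0]
  have hentry0 : zeroIndex (countEq u 0) K = 0 → nthEntry u K = 0 := by
    intro h0
    have hc : K = countEq u 0 ∧ 0 < countEq u 0 := by
      by_contra hc
      rw [zeroIndex, if_neg hc] at h0
      omega
    have := nthEntry_succ (u := u) ⟨K - 1, by omega⟩
    simp only [Nat.sub_add_cancel (show 1 ≤ K by omega)] at this
    rw [this, ← lt_countEq_zero_iff hu0 hu]
    simp only
    omega
  have hentry1 : zeroIndex (countEq u 0) K = 1 → 0 < K → 0 < nthEntry u K := by
    intro h0 hK1
    have hc : ¬ (K = countEq u 0 ∧ 0 < countEq u 0) := by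
      intro hc
      rw [zeroIndex, if_pos hc] at h0
      omega
    have := nthEntry_succ (u := u) ⟨K - 1, by omega⟩
    simp only [Nat.sub_add_cancel (show 1 ≤ K by omega)] at this
    rw [this]
    refine (hu0 _).lt_of_ne' ?_
    rw [Ne, ← lt_countEq_zero_iff hu0 hu]
    simp only
    omega
  refine ⟨w, ?_⟩
  funext p q
  rw [eq_iff_iff, A.rel_iff]
  unfold relOf
  simp only [h.homog, Bool.false_eq_true, and_false, or_false]
  by_cases hpq : p = q
  · simp [hpq]
  simp only [hpq, false_or]
  rw [Fin.lt_def, hext p, hext q, sub_le_sub_iff_right, Nat.cast_le, ← hext p, ← hext q]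
  constructor
  · intro hlt
    refine ⟨hlt.le, ?_⟩
    rcases hcases q with ⟨j, hj, rfl⟩ | hq
    · rw [(hhigh j hj).2]
      rcases hcases p with ⟨i, hi, rfl⟩ | hp
      · rw [(hhigh i hi).1]
        rw [h.idx_succ, h.idx_succ] at hlt
        exact lt_of_posIndex_lt hu hi hlt
      · rw [minVal_of_nonpos (hlow p hp)]
        exact hpos j hj
    · have hq1 : (A.idx q : ℕ) = 1 := by omega
      have hp0 : (A.idx p : ℕ) = 0 := by omega
      have hq0 := hidx1 q hq1
      subst hq0
      rw [minVal_of_nonpos (hlow p (by omega)), maxVal_of_nonneg (by simp), ext0_zero, hnum]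
      refine hentry1 (by omega) ?_
      obtain ⟨p', rfl⟩ := Fin.exists_succ_eq.2 hpq
      obtain ⟨i, rfl⟩ := τ.surjective p'
      rw [h.idx_succ, posIndex_eq_zero_iff] at hp0
      omega
  · rintro ⟨hle, hlt⟩
    refine hle.lt_of_ne fun heq => ?_
    rcases hcases q with ⟨j, hj, rfl⟩ | hq
    · rw [(hhigh j hj).2] at hlt
      rcases hcases p with ⟨i, hi, rfl⟩ | hp
      · rw [(hhigh i hi).1] at hlt
        rw [h.idx_succ, h.idx_succ] at heq
        exact hlt.ne (eq_of_posIndex_eq hu hi hj heq)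
      · rw [h.idx_succ, posIndex_of_le hj] at heq
        omega
    · have hq1 : (A.idx q : ℕ) = 0 := by
        by_contra hne
        have hq1 : (A.idx q : ℕ) = 1 := by omega
        exact hpq ((hidx1 p (by omega)).trans (hidx1 q hq1).symm)
      rw [minVal_of_nonpos (hlow p (by omega))] at hlt
      have hmax : maxVal u w (ext0 w q) = 0 := by
        rcases (hlow q hq).lt_or_eq with hneg | hzero
        · exact maxVal_of_neg hneg
        · rw [maxVal_of_nonneg hzero.ge, hzero, hnum]
          refine hentry0 ?_
          rw [hext, sub_eq_zero, Nat.cast_inj] at hzero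
          omega
      exact hlt.ne hmax.symm

lemma exists_isChamber (hK : K ≤ n) (τ : Equiv.Perm (Fin n)) :
    ∃ A, IsChamber u K τ A := by
  classical
  have hz1 := zeroIndex_le (countEq u 0) K
  let g : Fin (n + 1) → Fin ((tailValues u K).length + 2) :=
    Fin.cons ⟨zeroIndex (countEq u 0) K, by omega⟩
      fun i => ⟨posIndex u K (τ.symm i), posIndex_lt _⟩
  have g0 : (g 0 : ℕ) = zeroIndex (countEq u 0) K := rfl
  have gs : ∀ i : Fin n, (g i.succ : ℕ) = posIndex u K (τ.symm i) := fun i => rfl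
  let blk : Fin ((tailValues u K).length + 2) → Finset (Fin (n + 1)) :=
    fun t => Finset.univ.filter (g · = t)
  have hblk : ∀ p t, p ∈ blk t ↔ g p = t := fun p t => by simp [blk]
  have hone : ((1 : Fin ((tailValues u K).length + 2)) : ℕ) = 1 := rfl
  have hzero : ((0 : Fin ((tailValues u K).length + 2)) : ℕ) = 0 := rfl
  have hb1 : ∀ p ∈ blk 1, p = 0 := by
    intro p
    rw [hblk, Fin.ext_iff, hone]
    induction p using Fin.cases with
    | zero => intro _; rfl
    | succ p => intro h; exact absurd h (posIndex_ne_one _)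
  let A : SkewedBinaryPartition n :=
    { k := (tailValues u K).length
      block := blk
      homog := fun _ => false
      disjoint := fun i j hij => Finset.disjoint_left.2 fun p hi hj =>
        hij (((hblk p i).1 hi).symm.trans ((hblk p j).1 hj))
      cover := fun p => ⟨g p, (hblk p _).2 rfl⟩
      homog_first := rfl
      homog_second := fun hc => by
        obtain ⟨p, hp, q, hq, hpq⟩ := Finset.one_lt_card.1 hc
        exact absurd ((hb1 p hp).trans (hb1 q hq).symm) hpq
      zero_mem := by
        rw [hblk, hblk, Fin.ext_iff, Fin.ext_iff, hone, hzero, g0]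
        omega
      of_zero_mem_first := fun h0 => by
        have h0' := h0
        rw [hblk, Fin.ext_iff, hzero, g0] at h0'
        have hc : K = countEq u 0 ∧ 0 < countEq u 0 := by
          by_contra hc
          rw [zeroIndex, if_neg hc] at h0'
          omega
        constructor
        · refine Finset.one_lt_card.2 ⟨0, h0, (τ ⟨0, by omega⟩).succ, ?_, (Fin.succ_ne_zero _).symm⟩
          rw [hblk, Fin.ext_iff, gs, Equiv.symm_apply_apply, hzero, posIndex_eq_zero_iff]
          simp only
          omega
        · rw [Finset.eq_empty_iff_forall_notMem]
          intro p hp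
          have hp0 := hb1 p hp
          rw [hblk, hp0, Fin.ext_iff, g0, h0', hone] at hp
          omega
      two_le_of_homog := fun i h => by simp at h
      nonempty := fun t => by
        obtain ⟨i, hi, hi'⟩ := mem_tailValues.1 (List.getElem_mem t.2)
        refine ⟨(τ i).succ, (hblk _ _).2 ?_⟩
        rw [Fin.ext_iff, gs, Equiv.symm_apply_apply, (posIndex_eq_add_two_iff t.2).2 ⟨hi, hi'⟩]
        simp }
  have hidx : ∀ p, A.idx p = g p := fun p => A.mem_block_iff.1 ((hblk p _).2 rfl)
  refine ⟨A, rfl, fun _ => rfl, ?_, fun i => ?_⟩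
  · rw [hidx, g0]
  · rw [hidx, gs, Equiv.symm_apply_apply]

/-- Every functional lies in the sliced cone of a partition with type in `Ω_m`. -/
lemma exists_chamber_mem (hu0 : ∀ i, 0 ≤ u i) (hu : Monotone u) (hne : u ≠ 0) (w : Fin n → ℝ) :
    ∃ A : SkewedBinaryPartition n, A.type ∈ Omega (multiplicityVector u) ∧
      w ∈ slicedCone A.rel := by
  obtain ⟨τ, hτ⟩ := exists_sorting w
  -- The cut should come after the coordinates with `w ≤ 0` but not before m₀. If m₀ is larger,
  -- positive coordinates enter the first block together with 0, where no inequality is imposed on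
  -- them.
  obtain ⟨K, hK⟩ : ∃ K, K = max (countEq u 0) (numLE w 0) := ⟨_, rfl⟩
  have hK0 : countEq u 0 ≤ K := hK ▸ le_max_left _ _
  have hK1 : numLE w 0 ≤ K := hK ▸ le_max_right _ _
  have hKn : K ≤ n := hK ▸ max_le (countEq_zero_lt hu0 hne).le (numLE_le w 0)
  obtain ⟨A, hA⟩ := exists_isChamber hKn τ
  have hz1 := zeroIndex_le (countEq u 0) K
  refine ⟨A, (mem_Omega_iff hu0 hu hne _).2 ⟨K, hK0, hKn, hA.type_eq hKn⟩, ?_⟩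
  rw [mem_slicedCone]
  intro p q hpq
  rw [A.rel_iff] at hpq
  simp only [hA.homog, Bool.false_eq_true, and_false, or_false] at hpq
  rcases hpq with rfl | hpq
  · exact le_rfl
  rw [Fin.lt_def] at hpq
  induction p using Fin.cases with
  | zero =>
    induction q using Fin.cases with
    | zero => exact le_rfl
    | succ q =>
      obtain ⟨j, rfl⟩ := τ.surjective q
      rw [hA.idx_succ] at hpq
      have hj : ¬ (j : ℕ) < numLE w 0 := by
        intro hj
        rw [posIndex_of_lt (by omega)] at hpq
        omega
      rw [lt_numLE_iff hτ] at hj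
      simpa using (not_le.1 hj).le
  | succ p =>
    obtain ⟨i, rfl⟩ := τ.surjective p
    rw [hA.idx_succ] at hpq
    induction q using Fin.cases with
    | zero =>
      rw [hA.idx_zero] at hpq
      have hi : (i : ℕ) < K := by
        rw [← posIndex_eq_zero_iff (u := u)]
        omega
      have hc : ¬ (K = countEq u 0 ∧ 0 < countEq u 0) := by
        intro hc
        rw [zeroIndex, if_pos hc] at hpq
        omega
      -- As 0 is not in the first block, K = m₀ > 0 is excluded, so here `K` is `numLE w 0`.
      have hi' : (i : ℕ) < numLE w 0 := by omega
      rw [lt_numLE_iff hτ] at hi'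
      simpa using hi'
    | succ q =>
      obtain ⟨j, rfl⟩ := τ.surjective q
      rw [hA.idx_succ] at hpq
      have hij : i < j := not_le.1 fun h => hpq.not_ge (posIndex_mono hu h)
      simpa using hτ hij.le

lemma exists_relOf_of_type_mem (hu0 : ∀ i, 0 ≤ u i) (hu : Monotone u) (hne : u ≠ 0)
    {A : SkewedBinaryPartition n} (h : A.type ∈ Omega (multiplicityVector u)) :
    ∃ w, A.rel = relOf u w := by
  obtain ⟨K, hK0, hK, hA⟩ := (mem_Omega_iff hu0 hu hne _).1 h
  obtain ⟨τ, hτ⟩ := exists_isChamber_of_type hK hA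
  exact hτ.exists_rel_eq hu0 hu hK0 hK

end Chamber

/-! ### The normal fan and the face poset -/

section Main

variable {n : ℕ} {u : Fin n → ℝ}

lemma SBP.exists_relOf (hu0 : ∀ i, 0 ≤ u i) (hu : Monotone u) (hne : u ≠ 0)
    (B : SBP n (multiplicityVector u)) : ∃ w, B.1.rel = relOf u w := by
  obtain ⟨A, hA, hBA⟩ := B.2
  obtain ⟨w, hw⟩ := exists_relOf_of_type_mem hu0 hu hne hA
  rw [hw] at hBA
  exact exists_relOf_eq_of_isContraction hu0 hu hBA

/-- A chamber whose cone contains `w` supplies the partition of type in Ω_m of which the partition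
of `w` is a contraction. -/
lemma SBP.exists_of_relOf (hu0 : ∀ i, 0 ≤ u i) (hu : Monotone u) (hne : u ≠ 0) (w : Fin n → ℝ) :
    ∃ B : SBP n (multiplicityVector u), B.1.rel = relOf u w := by
  obtain ⟨B, hB⟩ := exists_rel_eq_relOf hu0 hu w
  obtain ⟨A, hA, hwA⟩ := exists_chamber_mem hu0 hu hne w
  obtain ⟨w₀, hw₀⟩ := exists_relOf_of_type_mem hu0 hu hne hA
  refine ⟨⟨B, A, hA, ?_⟩, hB⟩
  rw [hB, hw₀]
  rw [hw₀] at hwA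
  exact isContraction_relOf hu0 hu hwA

lemma SBP.slicedCone_subset_iff (hu0 : ∀ i, 0 ≤ u i) (hu : Monotone u) (hne : u ≠ 0)
    (B B' : SBP n (multiplicityVector u)) :
    slicedCone B.1.rel ⊆ slicedCone B'.1.rel ↔ B ≤ B' := by
  constructor
  · intro h
    obtain ⟨w, hw⟩ := B.exists_relOf hu0 hu hne
    obtain ⟨w', hw'⟩ := B'.exists_relOf hu0 hu hne
    change IsContraction B.1.rel B'.1.rel
    rw [hw, hw'] at h ⊢
    exact isContraction_relOf hu0 hu (h (relOf_strictFor u w).1)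
  · intro h
    have := B'.1.rel_isPreorder
    exact slicedCone_anti (IsContraction.generatedByReversals h).2.1

/-- The isomorphism from `SBP(m)` to the normal fan given by sliced preorder cones. -/
theorem exists_orderIso_normalFan (hu0 : ∀ i, 0 ≤ u i) (hu : Monotone u) (hne : u ≠ 0) :
    ∃ e : SBP n (multiplicityVector u) ≃o normalFan (PF u),
      ∀ B, (e B : Set (Fin n → ℝ)) = slicedCone B.1.rel := by
  have hmem : ∀ B : SBP n (multiplicityVector u), slicedCone B.1.rel ∈ normalFan (PF u) := by
    intro B
    obtain ⟨w, hw⟩ := B.exists_relOf hu0 hu hne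
    exact (mem_normalFan_iff hu0 hu _).2 ⟨w, by rw [hw]⟩
  let f : SBP n (multiplicityVector u) → normalFan (PF u) := fun B => ⟨slicedCone B.1.rel, hmem B⟩
  have hinj : Function.Injective f := by
    intro B B' h
    have := B.1.rel_isPreorder
    have := B'.1.rel_isPreorder
    exact Subtype.ext (SkewedBinaryPartition.rel_injective
      (eq_of_slicedCone_eq (congrArg Subtype.val h)))
  have hsurj : Function.Surjective f := by
    rintro ⟨σ, hσ⟩
    obtain ⟨w, rfl⟩ := (mem_normalFan_iff hu0 hu σ).1 hσ
    obtain ⟨B, hB⟩ := SBP.exists_of_relOf hu0 hu hne w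
    exact ⟨B, Subtype.ext (by simp only [f, hB])⟩
  exact ⟨⟨Equiv.ofBijective f ⟨hinj, hsurj⟩,
    fun {B B'} => SBP.slicedCone_subset_iff hu0 hu hne B B'⟩, fun B => rfl⟩

lemma nonempty_faces_orderIso (hu0 : ∀ i, 0 ≤ u i) (hu : Monotone u) (hne : u ≠ 0) :
    Nonempty (faces (PF u) ≃o (SBP n (multiplicityVector u))ᵒᵈ) := by
  obtain ⟨e, -⟩ := exists_orderIso_normalFan hu0 hu hne
  exact ⟨(facesOrderIso (PF u)).trans e.symm.dual⟩

end Main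

end ParkingPolytope


theorem mainTheorem4 {n : ℕ} (m : List ℕ) (d : List ℝ) (u : Fin n → ℝ)
    (hu : ParkingPolytope.IsMDPairOf m d u) :
    (∃ e : ParkingPolytope.SBP n m ≃o ParkingPolytope.normalFan (ParkingPolytope.PF u),
      ∀ B : ParkingPolytope.SBP n m,
        (e B : Set (Fin n → ℝ)) = ParkingPolytope.slicedCone B.1.rel) ∧
    Nonempty (ParkingPolytope.faces (ParkingPolytope.PF u) ≃o (ParkingPolytope.SBP n m)ᵒᵈ) ∧
    (∀ (n' : ℕ) (d' : List ℝ) (u' : Fin n' → ℝ), ParkingPolytope.IsMDPairOf m d' u' →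
      Nonempty (ParkingPolytope.faces (ParkingPolytope.PF u) ≃o
        ParkingPolytope.faces (ParkingPolytope.PF u'))) := by
  have hm := hu.multiplicity
  subst hm
  have hiso := ParkingPolytope.nonempty_faces_orderIso hu.nonneg hu.monotone hu.ne_zero
  refine ⟨ParkingPolytope.exists_orderIso_normalFan hu.nonneg hu.monotone hu.ne_zero, hiso, ?_⟩
  intro n' d' u' hu'
  -- The multiplicities sum to the dimension.
  have hn : n = n' := by
    rw [← ParkingPolytope.countEq_zero_add_sum hu.nonneg,
      ← ParkingPolytope.countEq_zero_add_sum hu'.nonneg, ← List.sum_cons, ← List.sum_cons,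
      ← ParkingPolytope.multiplicityVector_eq, ← ParkingPolytope.multiplicityVector_eq,
      hu'.multiplicity]
  subst hn
  have hiso' := ParkingPolytope.nonempty_faces_orderIso hu'.nonneg hu'.monotone hu'.ne_zero
  rw [hu'.multiplicity] at hiso'
  exact ⟨hiso.some.trans hiso'.some.symm⟩
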